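/- Let $d\ge 1$ and let $(x,y)$ be a square-integrable random vector in $\mathbb{R}^d\times\mathbb{R}$. Put $H=E(xx^T)$, assume that $H$ is positive-definite with smallest eigenvalue $\lambda_{\min}$, let $\theta^*$ be the unique solution of $H\theta^*=E(yx)$, and write $\|v\|_H^2=v^THv$. Assume that $\sigma,R>0$ satisfy (the expectations being finite) $$E\big((y-x^T\theta^*)^2xx^T\big)\preccurlyeq\sigma^2H,\qquad E\big(\|x\|^2xx^T\big)\preccurlyeq R^2H,$$ where $A\preccurlyeq B$ means that $B-A$ is positive semi-definite. Let $0<\gamma<2/R^2$, $0<\alpha\le 1/2$, $\delta>1$, $\theta_0\in\mathbb{R}^d$, let $k\ge2$ be an integer and $s(k)=\lceil\alpha k\rceil$. Let $((x_t,y_t),t\in\mathbb{Z})$ be independent copies of $(x,y)$. For $m\in\mathbb{Z}$ define $\theta_{m:m}=\theta_0$ and $\theta_{m:t+1}=\theta_{m:t}-\gamma(x_t^T\theta_{m:t}-y_t)x_t$ for $t\ge m$; put $\theta_t=\theta_{0:t}$ for $t\ge0$ and $\bar\theta_k=\frac1{k-s(k)}\sum_{t=s(k)}^{k-1}\theta_t$.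 Let $\tau(k,0)$ be uniformly distributed on $\{s(k),\dots,k-1\}$ and, for $l\ge1$, let $\tau(k,l)$ be uniformly distributed on $\{k(2^l-1),\dots,k(2^{l+1}-1)-1\}$. Let $N$ be a random variable with values in $\{0,1,2,\dots\}$ such that, for $l\ge0$, $$\Pr(N=l)=p_l:=\frac1{2^l(l+1)^\delta}-\frac1{2^{l+1}(l+2)^\delta}.$$ Assume that $N$, $\tau(k,l)$ ($l\ge0$) and $(x_t,y_t)$ ($t\in\mathbb{Z}$) are mutually independent. Set $f_{k,l}=\theta_{-\tau(k,l):0}$ and $$Z_k=\frac{f_{k,N+1}-f_{k,N}}{p_N},\quad c=\frac{\sigma^2d}{(2-\gamma R^2)^2}+\frac{\|\theta_0-\theta^*\|^2}{\gamma(2-\gamma R^2)},\quad \xi=\gamma(2-\gamma R^2)\lambda_{\min}.$$ Then $Z_k$ is square-integrable, $\bar\theta_k$ is integrable, $E(Z_k)=\theta^*-E(\bar\theta_k)$, and $$kE(\|Z_k\|_H^2)\le\frac{11c}{\alpha}+6c\left(4\ln\left(\frac{4\delta+8}{\alpha\xi}\right)\right)^{\delta+1}.$$ Furthermore, if $k\ge\frac{4\delta+8}{\alpha\xi}\ln\left(\frac{4\delta+8}{\alpha\xi}\right)$,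 then $$kE(\|Z_k\|_H^2)\le\frac{24c}{k^{\delta+1}}\exp(-\alpha\xi k/2).$$ -/

import Mathlib

open MeasureTheory ProbabilityTheory

namespace LeastSquaresSGD

noncomputable section

/-- The Hessian matrix `H = E(x xᵀ)`. -/
def hessian {d : ℕ} {Ω : Type*} [MeasurableSpace Ω] (P : Measure Ω)
    (x : Ω → EuclideanSpace ℝ (Fin d)) : Matrix (Fin d) (Fin d) ℝ :=
  Matrix.of fun i j => ∫ ω, x ω i * x ω j ∂P

/-- The vector `θ` solves the normal equation `H θ = E(y x)`. -/
def NormalEquation {d : ℕ} {Ω : Type*} [MeasurableSpace Ω] (P : Measure Ω)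
    (x : Ω → EuclideanSpace ℝ (Fin d)) (y : Ω → ℝ) (θ : EuclideanSpace ℝ (Fin d)) : Prop :=
  (hessian P x).mulVec θ.ofLp = fun i => ∫ ω, y ω * x ω i ∂P

/-- The matrix `E(w x xᵀ)` exists and `E(w x xᵀ) ≼ C`, where `A ≼ B` means that `B - A` is
positive semi-definite. -/
def WeightedSecondMomentLE {d : ℕ} {Ω : Type*} [MeasurableSpace Ω] (P : Measure Ω)
    (w : Ω → ℝ) (x : Ω → EuclideanSpace ℝ (Fin d)) (C : Matrix (Fin d) (Fin d) ℝ) : Prop :=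
  (∀ i j, Integrable (fun ω => w ω * (x ω i * x ω j)) P) ∧
    (C - Matrix.of fun i j => ∫ ω, w ω * (x ω i * x ω j) ∂P).PosSemidef

/-- The squared seminorm `‖v‖²_A = vᵀ A v` of a positive semi-definite matrix `A`. -/
def sqNorm {d : ℕ} (A : Matrix (Fin d) (Fin d) ℝ) (v : EuclideanSpace ℝ (Fin d)) : ℝ :=
  v.ofLp ⬝ᵥ A.mulVec v.ofLp

/-- The smallest eigenvalue of a (real symmetric) matrix. -/
def lambdaMin {d : ℕ} (A : Matrix (Fin d) (Fin d) ℝ) : ℝ :=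
  sInf {μ : ℝ | Module.End.HasEigenvalue (Matrix.toLin' A) μ}

/-- `sgdSteps γ θ₀ x y m n` is `θ_{m : m+n}`, the iterate after `n` steps of stochastic gradient
descent with step-size `γ` started at time `m` from `θ₀` and driven by `(x t, y t)`, `t ≥ m`. -/
def sgdSteps {d : ℕ} (γ : ℝ) (θ₀ : EuclideanSpace ℝ (Fin d))
    (x : ℤ → EuclideanSpace ℝ (Fin d)) (y : ℤ → ℝ) (m : ℤ) : ℕ → EuclideanSpace ℝ (Fin d)
  | 0 => θ₀
  | n + 1 =>
    sgdSteps γ θ₀ x y m n -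
      (γ * (inner ℝ (x (m + n)) (sgdSteps γ θ₀ x y m n) - y (m + n))) • x (m + n)

/-- `θ_{m:t}` for `m ≤ t`. -/
def sgd {d : ℕ} (γ : ℝ) (θ₀ : EuclideanSpace ℝ (Fin d))
    (x : ℤ → EuclideanSpace ℝ (Fin d)) (y : ℤ → ℝ) (m t : ℤ) : EuclideanSpace ℝ (Fin d) :=
  sgdSteps γ θ₀ x y m (t - m).toNat

/-- The burn-in period `s(k) = α k`, rounded up to an integer. -/
def burnIn (α : ℝ) (k : ℕ) : ℕ := ⌈α * k⌉₊

/-- The time-average estimator: the mean of `θ_t = θ_{0:t}` over `s(k) ≤ t ≤ k - 1`. -/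
def thetaBar {d : ℕ} {Ω : Type*} (γ α : ℝ) (θ₀ : EuclideanSpace ℝ (Fin d))
    (X : ℤ → Ω → EuclideanSpace ℝ (Fin d)) (Y : ℤ → Ω → ℝ) (k : ℕ) (ω : Ω) :
    EuclideanSpace ℝ (Fin d) :=
  ((k : ℝ) - (burnIn α k : ℝ))⁻¹ •
    ∑ t ∈ Finset.Ico (burnIn α k) k, sgd γ θ₀ (fun t => X t ω) (fun t => Y t ω) 0 t

/-- The set over which the random start `τ(k,l)` ranges: `{s(k), …, k - 1}` for `l = 0` and
`{k (2^l - 1), …, k (2^(l+1) - 1) - 1}` for `l ≥ 1`. -/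
def startRange (α : ℝ) (k l : ℕ) : Set ℕ :=
  if l = 0 then Set.Ico (burnIn α k) k else Set.Ico (k * (2 ^ l - 1)) (k * (2 ^ (l + 1) - 1))

/-- `f_{k,l} = θ_{-τ(k,l) : 0}`, where `τ l` stands for `τ(k,l)`. -/
def levelEstimator {d : ℕ} {Ω : Type*} (γ : ℝ) (θ₀ : EuclideanSpace ℝ (Fin d))
    (X : ℤ → Ω → EuclideanSpace ℝ (Fin d)) (Y : ℤ → Ω → ℝ) (τ : ℕ → Ω → ℕ) (l : ℕ) (ω : Ω) :
    EuclideanSpace ℝ (Fin d) :=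
  sgd γ θ₀ (fun t => X t ω) (fun t => Y t ω) (-(τ l ω : ℤ)) 0

/-- The probability `p_l` of the level `l`. -/
def levelProb (δ : ℝ) (l : ℕ) : ℝ :=
  1 / ((2 : ℝ) ^ l * ((l : ℝ) + 1) ^ δ) - 1 / ((2 : ℝ) ^ (l + 1) * ((l : ℝ) + 2) ^ δ)

/-- The single term estimator `Z_k = (f_{k,N+1} - f_{k,N}) / p_N`. -/
def Z {d : ℕ} {Ω : Type*} (γ δ : ℝ) (θ₀ : EuclideanSpace ℝ (Fin d))
    (X : ℤ → Ω → EuclideanSpace ℝ (Fin d)) (Y : ℤ → Ω → ℝ) (τ : ℕ → Ω → ℕ) (N : Ω → ℕ) (ω : Ω) :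
    EuclideanSpace ℝ (Fin d) :=
  (levelProb δ (N ω))⁻¹ •
    (levelEstimator γ θ₀ X Y τ (N ω + 1) ω - levelEstimator γ θ₀ X Y τ (N ω) ω)

/-- The constant `c`. -/
def cConst {d : ℕ} (γ σ R : ℝ) (θ₀ θstar : EuclideanSpace ℝ (Fin d)) : ℝ :=
  σ ^ 2 * d / (2 - γ * R ^ 2) ^ 2 + ‖θ₀ - θstar‖ ^ 2 / (γ * (2 - γ * R ^ 2))

/-- The constant `ξ`. -/
def xi {d : ℕ} (γ R : ℝ) (H : Matrix (Fin d) (Fin d) ℝ) : ℝ :=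
  γ * (2 - γ * R ^ 2) * lambdaMin H

end

end LeastSquaresSGD

/-! Write κ = γ(2 - γR²), ρ = 1 - ξ and s_l = `levelStart α k l`. The error of an iterate splits
into a bias path (noiseless steps v ↦ (I - γxxᵀ)v from θ₀ - θ*) and a noise path started from 0
(`sgdSteps_sub`). The mean of ‖(I - γxxᵀ)v‖² is at most ‖v‖² - κ‖v‖²_H. Telescoping this shows that
κ times the sum of the mean ‖·‖²_H along a noiseless path is at most its initial ‖v‖², and s
preliminary steps gain a factor ρ^s (`IsLeastSquaresLaw.mul_sum_excess_add_le`).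

Two runs ending at time 0 share their last data. If they start at -(i+n) and -n, their noise paths
differ by the older noise at time -n, propagated by n noiseless steps (`noisePath_add`). That noise
is centered with directional second moments at most a = γσ²/(2 - γR²)
(`CenteredWithMomentLE.gradStep_add`), so it costs no more than a times d noiseless paths started
from the basis vectors. The starts are uniform on consecutive ranges, so averaging over them turns
the sum bound into E‖f_{k,l+1} - f_{k,l}‖²_H ≤ 6cρ^{s_l}/(s_{l+1} - s_l)
(`lintegral_sqNorm_sgdEnd_sub_le`).

Conditioning on N gives E‖Z_k‖²_H = ∑ p_l⁻¹ E‖f_{k,l+1} - f_{k,l}‖²_H. As p_l⁻¹ ≤ 2^{l+1}(l+1)^δ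
while the ranges have length k2^l for l ≥ 1, the powers of 2 cancel, and k times the sum is
controlled by ∑ (l+1)^δ ρ^{s_l} (`mul_sum_levels_le`). The exponents s_l grow geometrically, so only
about log(1/ξ) levels matter (`sum_level_le`); for large k every level is exponentially small
(`sum_level_le_of_le`).

For the mean, conditioning on N cancels p_l and leaves a telescoping series (`integral_Z`). Its
limit is θ*, because the mean error is multiplied by the contraction I - γH at each step; its
initial term is the mean of the time average. -/

open scoped ENNReal

namespace LeastSquaresSGD

/-! ### Quadratic forms of symmetric matrices and the smallest eigenvalue -/

section Matrix

variable {d : ℕ}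

lemma sqNorm_eq_inner (A : Matrix (Fin d) (Fin d) ℝ) (v : EuclideanSpace ℝ (Fin d)) :
    sqNorm A v = inner ℝ v (Matrix.toEuclideanLin A v) := by
  simp [sqNorm, PiLp.inner_apply, dotProduct, Matrix.toLpLin_apply, mul_comm]

lemma sqNorm_nonneg {A : Matrix (Fin d) (Fin d) ℝ} (hA : A.PosSemidef)
    (v : EuclideanSpace ℝ (Fin d)) : 0 ≤ sqNorm A v := by
  simpa [sqNorm] using hA.dotProduct_mulVec_nonneg v.ofLp

lemma continuous_sqNorm (A : Matrix (Fin d) (Fin d) ℝ) : Continuous (sqNorm A) := by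
  simp only [funext (sqNorm_eq_inner A)]
  have := (Matrix.toEuclideanLin A).continuous_of_finiteDimensional
  fun_prop

/-- The squared seminorm in an orthonormal basis of eigenvectors. -/
lemma sqNorm_eq_sum_eigenvalues {A : Matrix (Fin d) (Fin d) ℝ} (hA : A.IsHermitian)
    (v : EuclideanSpace ℝ (Fin d)) :
    sqNorm A v = ∑ i, hA.eigenvalues i * inner ℝ (hA.eigenvectorBasis i) v ^ 2 := by
  rw [sqNorm_eq_inner]
  have h1 : Matrix.toEuclideanLin A v =
      ∑ i, (hA.eigenvalues i * inner ℝ (hA.eigenvectorBasis i) v) • hA.eigenvectorBasis i := by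
    conv_lhs => rw [← hA.eigenvectorBasis.sum_repr' v]
    rw [map_sum]
    refine Finset.sum_congr rfl fun i _ => ?_
    rw [map_smul, mul_comm, mul_smul]
    congr 1
    ext j
    simpa [Matrix.toLpLin_apply] using congrFun (hA.mulVec_eigenvectorBasis i) j
  rw [h1, inner_sum]
  refine Finset.sum_congr rfl fun i _ => ?_
  rw [inner_smul_right, real_inner_comm]
  ring

/-- Scaling the eigenvectors by the square roots of the eigenvalues reduces a claim on the form to a
claim on each direction. -/
lemma exists_sqNorm_eq_sum_sq {A : Matrix (Fin d) (Fin d) ℝ} (hA : A.PosSemidef) :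
    ∃ h : Fin d → EuclideanSpace ℝ (Fin d), ∀ v, sqNorm A v = ∑ i, inner ℝ (h i) v ^ 2 := by
  refine ⟨fun i => √(hA.1.eigenvalues i) • hA.1.eigenvectorBasis i, fun v => ?_⟩
  rw [sqNorm_eq_sum_eigenvalues hA.1]
  refine Finset.sum_congr rfl fun i _ => ?_
  rw [real_inner_smul_left, mul_pow, Real.sq_sqrt (hA.eigenvalues_nonneg i)]

lemma setOf_hasEigenvalue_eq {A : Matrix (Fin d) (Fin d) ℝ} (hA : A.IsHermitian) :
    {μ : ℝ | Module.End.HasEigenvalue (Matrix.toLin' A) μ} = Set.range hA.eigenvalues := by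
  rw [← hA.spectrum_real_eq_range_eigenvalues, ← Matrix.spectrum_toLin']
  ext μ
  exact Module.End.hasEigenvalue_iff_mem_spectrum

lemma lambdaMin_eq_sInf {A : Matrix (Fin d) (Fin d) ℝ} (hA : A.IsHermitian) :
    lambdaMin A = sInf (Set.range hA.eigenvalues) := by
  rw [lambdaMin, setOf_hasEigenvalue_eq hA]

lemma lambdaMin_pos (hd : 0 < d) {A : Matrix (Fin d) (Fin d) ℝ} (hA : A.PosDef) :
    0 < lambdaMin A := by
  have : Nonempty (Fin d) := ⟨⟨0, hd⟩⟩
  rw [lambdaMin_eq_sInf hA.1]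
  obtain ⟨i, hi⟩ := (Set.range_nonempty hA.1.eigenvalues).csInf_mem (Set.finite_range _)
  rw [← hi]
  exact hA.eigenvalues_pos i

lemma lambdaMin_mul_norm_sq_le {A : Matrix (Fin d) (Fin d) ℝ} (hA : A.IsHermitian)
    (v : EuclideanSpace ℝ (Fin d)) : lambdaMin A * ‖v‖ ^ 2 ≤ sqNorm A v := by
  rw [sqNorm_eq_sum_eigenvalues hA, ← hA.eigenvectorBasis.sum_sq_norm_inner_right, Finset.mul_sum]
  refine Finset.sum_le_sum fun i _ => ?_
  rw [Real.norm_eq_abs, sq_abs]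
  refine mul_le_mul_of_nonneg_right ?_ (sq_nonneg _)
  rw [lambdaMin_eq_sInf hA]
  exact csInf_le (Set.finite_range _).bddBelow ⟨i, rfl⟩

lemma sqNorm_smul (A : Matrix (Fin d) (Fin d) ℝ) (r : ℝ) (v : EuclideanSpace ℝ (Fin d)) :
    sqNorm A (r • v) = r ^ 2 * sqNorm A v := by
  simp only [sqNorm_eq_inner, map_smul, real_inner_smul_left, real_inner_smul_right]
  ring

lemma sqNorm_add_sub_le {A : Matrix (Fin d) (Fin d) ℝ} (hA : A.PosSemidef)
    (u v w : EuclideanSpace ℝ (Fin d)) :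
    sqNorm A (u - v + w) ≤ 3 * (sqNorm A u + sqNorm A v + sqNorm A w) := by
  obtain ⟨h, hh⟩ := exists_sqNorm_eq_sum_sq hA
  simp only [hh, ← Finset.sum_add_distrib, Finset.mul_sum]
  refine Finset.sum_le_sum fun i _ => ?_
  rw [inner_add_right, inner_sub_right]
  -- 3(a² + b² + c²) - (a - b + c)² = (a + b)² + (a - c)² + (b + c)².
  nlinarith [sq_nonneg (inner ℝ (h i) u + inner ℝ (h i) v),
    sq_nonneg (inner ℝ (h i) u - inner ℝ (h i) w), sq_nonneg (inner ℝ (h i) v + inner ℝ (h i) w)]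

end Matrix

/-! ### Moment conditions on the law of the data, tested on vectors -/

section Law

variable {d : ℕ}

/-- The moment properties of the law `μ` of the pair `(x, y)` in terms of which the analysis of
stochastic gradient descent is carried out. -/
structure IsLeastSquaresLaw (μ : Measure (EuclideanSpace ℝ (Fin d) × ℝ))
    (H : Matrix (Fin d) (Fin d) ℝ) (θ : EuclideanSpace ℝ (Fin d)) (σ R : ℝ) : Prop where
  integrable_inner_sq : ∀ u, Integrable (fun z => inner ℝ z.1 u ^ 2) μ
  integral_inner_sq : ∀ u, ∫ z, inner ℝ z.1 u ^ 2 ∂μ = sqNorm H u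
  integrable_norm_inner_sq : ∀ u, Integrable (fun z => ‖z.1‖ ^ 2 * inner ℝ z.1 u ^ 2) μ
  integral_norm_inner_sq_le : ∀ u, ∫ z, ‖z.1‖ ^ 2 * inner ℝ z.1 u ^ 2 ∂μ ≤ R ^ 2 * sqNorm H u
  integrable_resid_inner_sq : ∀ u,
    Integrable (fun z => (z.2 - inner ℝ z.1 θ) ^ 2 * inner ℝ z.1 u ^ 2) μ
  integral_resid_inner_sq_le : ∀ u,
    ∫ z, (z.2 - inner ℝ z.1 θ) ^ 2 * inner ℝ z.1 u ^ 2 ∂μ ≤ σ ^ 2 * sqNorm H u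
  integral_resid_inner : ∀ u, ∫ z, (z.2 - inner ℝ z.1 θ) * inner ℝ z.1 u ∂μ = 0

variable {Ω : Type*} [MeasurableSpace Ω] {P : Measure Ω}

lemma mul_inner_sq_eq_sum (w : ℝ) (x u : EuclideanSpace ℝ (Fin d)) :
    w * inner ℝ x u ^ 2 = ∑ i, ∑ j, u i * u j * (w * (x i * x j)) := by
  have : inner ℝ x u = ∑ i, x i * u i := by simp [PiLp.inner_apply, mul_comm]
  rw [this, sq, Finset.sum_mul_sum, Finset.mul_sum]
  refine Finset.sum_congr rfl fun i _ => ?_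
  rw [Finset.mul_sum]
  exact Finset.sum_congr rfl fun j _ => by ring

lemma integrable_mul_inner_sq {w : Ω → ℝ} {x : Ω → EuclideanSpace ℝ (Fin d)}
    (h : ∀ i j, Integrable (fun ω => w ω * (x ω i * x ω j)) P) (u : EuclideanSpace ℝ (Fin d)) :
    Integrable (fun ω => w ω * inner ℝ (x ω) u ^ 2) P := by
  simp only [mul_inner_sq_eq_sum]
  exact integrable_finsetSum _ fun i _ => integrable_finsetSum _ fun j _ => (h i j).const_mul _

lemma integral_mul_inner_sq {w : Ω → ℝ} {x : Ω → EuclideanSpace ℝ (Fin d)}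
    (h : ∀ i j, Integrable (fun ω => w ω * (x ω i * x ω j)) P) (u : EuclideanSpace ℝ (Fin d)) :
    ∫ ω, w ω * inner ℝ (x ω) u ^ 2 ∂P =
      sqNorm (Matrix.of fun i j => ∫ ω, w ω * (x ω i * x ω j) ∂P) u := by
  simp only [mul_inner_sq_eq_sum]
  rw [integral_finsetSum _ fun i _ => integrable_finsetSum _ fun j _ => (h i j).const_mul _]
  simp only [sqNorm, dotProduct, Matrix.mulVec, Matrix.of_apply, Finset.mul_sum]
  refine Finset.sum_congr rfl fun i _ => ?_
  rw [integral_finsetSum _ fun j _ => (h i j).const_mul _]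
  refine Finset.sum_congr rfl fun j _ => ?_
  rw [integral_const_mul]
  ring

lemma sqNorm_le_of_posSemidef_sub {A B : Matrix (Fin d) (Fin d) ℝ} (h : (B - A).PosSemidef)
    (u : EuclideanSpace ℝ (Fin d)) : sqNorm A u ≤ sqNorm B u := by
  have := sqNorm_nonneg h u
  simp only [sqNorm, Matrix.sub_mulVec, dotProduct_sub] at this ⊢
  linarith

lemma sqNorm_smul_matrix (A : Matrix (Fin d) (Fin d) ℝ) (r : ℝ) (u : EuclideanSpace ℝ (Fin d)) :
    sqNorm (r • A) u = r * sqNorm A u := by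
  simp [sqNorm, Matrix.smul_mulVec]

lemma memLp_coord {x : Ω → EuclideanSpace ℝ (Fin d)} (hx : MemLp x 2 P) (i : Fin d) :
    MemLp (fun ω => x ω i) 2 P := by
  refine hx.mono ?_ (Filter.Eventually.of_forall fun ω => PiLp.norm_apply_le (x ω) i)
  exact (EuclideanSpace.proj (𝕜 := ℝ) i).continuous.comp_aestronglyMeasurable hx.1

/-- The normal equation, tested on u: the residual is uncorrelated with every linear function of x.
This makes the noise centered. -/
lemma integral_resid_mul_inner [IsProbabilityMeasure P] {x : Ω → EuclideanSpace ℝ (Fin d)}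
    {y : Ω → ℝ} (hx : MemLp x 2 P) (hy : MemLp y 2 P) {θ : EuclideanSpace ℝ (Fin d)}
    (hθ : NormalEquation P x y θ) (u : EuclideanSpace ℝ (Fin d)) :
    ∫ ω, (y ω - inner ℝ (x ω) θ) * inner ℝ (x ω) u ∂P = 0 := by
  have hxx : ∀ i j, Integrable (fun ω => x ω i * x ω j) P := fun i j =>
    (memLp_coord hx i).integrable_mul (memLp_coord hx j)
  have hyx : ∀ i, Integrable (fun ω => y ω * x ω i) P := fun i =>
    hy.integrable_mul (memLp_coord hx i)
  have e : ∀ ω, (y ω - inner ℝ (x ω) θ) * inner ℝ (x ω) u =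
      ∑ i, u i * (y ω * x ω i - ∑ j, θ j * (x ω i * x ω j)) := by
    intro ω
    have h : ∀ v, inner ℝ (x ω) v = ∑ i, x ω i * v i := by
      intro v; simp [PiLp.inner_apply, mul_comm]
    rw [h, h, Finset.mul_sum]
    refine Finset.sum_congr rfl fun i _ => ?_
    rw [sub_mul, mul_sub, Finset.sum_mul, Finset.mul_sum]
    congr 1
    · ring
    · exact Finset.sum_congr rfl fun j _ => by ring
  simp only [e]
  have hs : ∀ i, Integrable (fun ω => ∑ j, θ j * (x ω i * x ω j)) P := fun i =>
    integrable_finsetSum _ fun j _ => (hxx i j).const_mul _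
  have hd : ∀ i, Integrable
      (fun ω => u i * (y ω * x ω i - ∑ j, θ j * (x ω i * x ω j))) P := fun i =>
    ((hyx i).sub (hs i)).const_mul _
  rw [integral_finsetSum _ fun i _ => hd i]
  refine Finset.sum_eq_zero fun i _ => ?_
  rw [integral_const_mul, integral_sub (hyx i) (hs i),
    integral_finsetSum _ fun j _ => (hxx i j).const_mul _]
  have := congrFun hθ i
  simp only [Matrix.mulVec, dotProduct, hessian, Matrix.of_apply] at this
  simp only [integral_const_mul, ← this]
  simp [mul_comm]

/-- Matrix inequalities become scalar ones by testing on u. Stating them for the law of the pair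
makes them available for every independent copy. -/
lemma isLeastSquaresLaw_map [IsProbabilityMeasure P] {x : Ω → EuclideanSpace ℝ (Fin d)}
    {y : Ω → ℝ} (hx : MemLp x 2 P) (hy : MemLp y 2 P) {θ : EuclideanSpace ℝ (Fin d)}
    (hθ : NormalEquation P x y θ) {σ R : ℝ}
    (hAσ : WeightedSecondMomentLE P (fun ω => (y ω - inner ℝ (x ω) θ) ^ 2) x
      (σ ^ 2 • hessian P x))
    (hAR : WeightedSecondMomentLE P (fun ω => ‖x ω‖ ^ 2) x (R ^ 2 • hessian P x)) :
    IsLeastSquaresLaw (P.map fun ω => (x ω, y ω)) (hessian P x) θ σ R := by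
  have hm : AEMeasurable (fun ω => (x ω, y ω)) P := hx.1.aemeasurable.prodMk hy.1.aemeasurable
  -- The weight 1 makes H an instance of the weighted moments.
  have hxx : ∀ i j, Integrable (fun ω => 1 * (x ω i * x ω j)) P := fun i j =>
    ((memLp_coord hx i).integrable_mul (memLp_coord hx j)).congr
      (Filter.Eventually.of_forall fun ω => by simp)
  have hxx' := fun u => integrable_mul_inner_sq hxx u
  have hxx'' := fun u => integral_mul_inner_sq hxx u
  simp only [one_mul] at hxx' hxx''
  refine ⟨fun u => ?_, fun u => ?_, fun u => ?_, fun u => ?_, fun u => ?_, fun u => ?_,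
    fun u => ?_⟩
  · rw [integrable_map_measure (by fun_prop) hm]
    exact hxx' u
  · rw [integral_map hm (by fun_prop)]
    exact hxx'' u
  · rw [integrable_map_measure (by fun_prop) hm]
    exact integrable_mul_inner_sq hAR.1 u
  · rw [integral_map hm (by fun_prop), integral_mul_inner_sq hAR.1, ← sqNorm_smul_matrix]
    exact sqNorm_le_of_posSemidef_sub hAR.2 u
  · rw [integrable_map_measure (by fun_prop) hm]
    exact integrable_mul_inner_sq hAσ.1 u
  · rw [integral_map hm (by fun_prop), integral_mul_inner_sq hAσ.1, ← sqNorm_smul_matrix]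
    exact sqNorm_le_of_posSemidef_sub hAσ.2 u
  · rw [integral_map hm (by fun_prop)]
    exact integral_resid_mul_inner hx hy hθ u

end Law

/-! ### The past of a sequence, and integration over independent variables -/

section Past

/-- The σ-algebra generated by the terms of index `s < t` of a sequence. -/
@[reducible] def past {Ω T : Type*} [MeasurableSpace T] (Z : ℤ → Ω → T) (t : ℤ) :
    MeasurableSpace Ω :=
  ⨆ s ∈ Set.Iio t, MeasurableSpace.comap (Z s) inferInstance

lemma past_mono {Ω T : Type*} [MeasurableSpace T] (Z : ℤ → Ω → T) {s t : ℤ} (hst : s ≤ t) :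
    past Z s ≤ past Z t :=
  biSup_mono fun _ hr => lt_of_lt_of_le hr hst

lemma measurable_past {Ω T : Type*} [MeasurableSpace T] (Z : ℤ → Ω → T) {s t : ℤ} (hst : s < t) :
    Measurable[past Z t] (Z s) := by
  rw [measurable_iff_comap_le]
  exact le_iSup₂_of_le s hst le_rfl

end Past

section Independence

variable {Ω S T : Type*} [MeasurableSpace Ω] [MeasurableSpace S] [MeasurableSpace T]
  {P : Measure Ω}

/-- Tonelli for the product law: freeze V and average over Z. The symmetric version freezes Z
instead. -/
lemma lintegral_indepFun [IsProbabilityMeasure P] {V : Ω → S} {Z : Ω → T} (hV : Measurable V)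
    (hZ : Measurable Z)
    (h : IndepFun V Z P) {g : S → T → ℝ≥0∞} (hg : Measurable (Function.uncurry g)) :
    ∫⁻ ω, g (V ω) (Z ω) ∂P = ∫⁻ ω, ∫⁻ z, g (V ω) z ∂(P.map Z) ∂P := by
  have hmap := (indepFun_iff_map_prod_eq_prod_map_map hV.aemeasurable hZ.aemeasurable).1 h
  have : IsProbabilityMeasure (P.map Z) := Measure.isProbabilityMeasure_map hZ.aemeasurable
  calc ∫⁻ ω, g (V ω) (Z ω) ∂P
      = ∫⁻ p, Function.uncurry g p ∂(P.map fun ω => (V ω, Z ω)) :=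
        (lintegral_map hg (hV.prodMk hZ)).symm
    _ = ∫⁻ v, ∫⁻ z, g v z ∂(P.map Z) ∂(P.map V) := by
        rw [hmap, lintegral_prod _ hg.aemeasurable]; rfl
    _ = _ := lintegral_map (Measurable.lintegral_prod_right' (f := Function.uncurry g) hg) hV

lemma lintegral_indepFun_symm [IsProbabilityMeasure P] {V : Ω → S} {Z : Ω → T} (hV : Measurable V)
    (hZ : Measurable Z)
    (h : IndepFun V Z P) {g : S → T → ℝ≥0∞} (hg : Measurable (Function.uncurry g)) :
    ∫⁻ ω, g (V ω) (Z ω) ∂P = ∫⁻ z, ∫⁻ ω, g (V ω) z ∂P ∂(P.map Z) := by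
  have : IsProbabilityMeasure (P.map Z) := Measure.isProbabilityMeasure_map hZ.aemeasurable
  rw [lintegral_indepFun hV hZ h hg]
  exact lintegral_lintegral_swap
    (hg.comp ((hV.comp measurable_fst).prodMk measurable_snd)).aemeasurable

variable {E : Type*} [NormedAddCommGroup E] [NormedSpace ℝ E]

lemma integral_indepFun_symm [IsProbabilityMeasure P] {V : Ω → S} {Z : Ω → T} (hV : Measurable V)
    (hZ : Measurable Z)
    (h : IndepFun V Z P) {g : S → T → E} (hg : StronglyMeasurable (Function.uncurry g))
    (hint : Integrable (fun ω => g (V ω) (Z ω)) P) :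
    ∫ ω, g (V ω) (Z ω) ∂P = ∫ z, ∫ ω, g (V ω) z ∂P ∂(P.map Z) := by
  have hmap := (indepFun_iff_map_prod_eq_prod_map_map hV.aemeasurable hZ.aemeasurable).1 h
  have : IsProbabilityMeasure (P.map Z) := Measure.isProbabilityMeasure_map hZ.aemeasurable
  have : IsProbabilityMeasure (P.map V) := Measure.isProbabilityMeasure_map hV.aemeasurable
  have hint' : Integrable (Function.uncurry g) ((P.map V).prod (P.map Z)) := by
    rw [← hmap, integrable_map_measure hg.aestronglyMeasurable (hV.prodMk hZ).aemeasurable]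
    exact hint
  calc ∫ ω, g (V ω) (Z ω) ∂P
      = ∫ p, Function.uncurry g p ∂(P.map fun ω => (V ω, Z ω)) :=
        (integral_map (hV.prodMk hZ).aemeasurable hg.aestronglyMeasurable).symm
    _ = ∫ z, ∫ v, g v z ∂(P.map V) ∂(P.map Z) := by
        rw [hmap, integral_prod_symm _ hint']; rfl
    _ = _ := by
        refine integral_congr_ae (Filter.Eventually.of_forall fun z => ?_)
        exact integral_map hV.aemeasurable
          (hg.comp_measurable (measurable_id.prodMk measurable_const)).aestronglyMeasurable

lemma past_le {Z : ℤ → Ω → T} (hZ : ∀ t, Measurable (Z t)) (t : ℤ) :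
    past Z t ≤ ‹MeasurableSpace Ω› :=
  iSup₂_le fun s _ => (hZ s).comap_le

lemma indepFun_of_past {Z : ℤ → Ω → T} (hZ : ∀ t, Measurable (Z t)) (h : iIndepFun Z P) {t : ℤ}
    {V : Ω → S} (hV : Measurable[past Z t] V) : IndepFun V (Z t) P := by
  have := indep_iSup_of_disjoint (fun i => (hZ i).comap_le) h.iIndep
    (S := Set.Iio t) (T := {t}) (by simp)
  rw [IndepFun_iff_Indep]
  refine indep_of_indep_of_le_left (indep_of_indep_of_le_right this ?_) ?_
  · exact le_iSup₂_of_le t rfl le_rfl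
  · exact measurable_iff_comap_le.1 hV

end Independence

/-! ### One noiseless step -/

section Step

variable {d : ℕ}

/-- One noiseless step `v ↦ (I - γ x xᵀ) v` of stochastic gradient descent. -/
noncomputable def gradStep (γ : ℝ) (x v : EuclideanSpace ℝ (Fin d)) : EuclideanSpace ℝ (Fin d) :=
  v - (γ * inner ℝ x v) • x

lemma continuous_gradStep (γ : ℝ) :
    Continuous fun p : EuclideanSpace ℝ (Fin d) × EuclideanSpace ℝ (Fin d) =>
      gradStep γ p.1 p.2 := by
  unfold gradStep
  fun_prop

@[fun_prop]
lemma measurable_gradStep {A : Type*} {_ : MeasurableSpace A} (γ : ℝ)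
    {x v : A → EuclideanSpace ℝ (Fin d)} (hx : Measurable x) (hv : Measurable v) :
    Measurable fun a => gradStep γ (x a) (v a) :=
  (continuous_gradStep γ).measurable.comp (hx.prodMk hv)

/-- `gradStep` as a continuous linear map. -/
noncomputable def gradStepL (γ : ℝ) (x : EuclideanSpace ℝ (Fin d)) :
    EuclideanSpace ℝ (Fin d) →L[ℝ] EuclideanSpace ℝ (Fin d) :=
  ContinuousLinearMap.id ℝ _ - γ • (innerSL ℝ x).smulRight x

lemma gradStepL_apply (γ : ℝ) (x v : EuclideanSpace ℝ (Fin d)) :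
    gradStepL γ x v = gradStep γ x v := by
  simp [gradStepL, gradStep, mul_smul]

lemma gradStep_add (γ : ℝ) (x v w : EuclideanSpace ℝ (Fin d)) :
    gradStep γ x (v + w) = gradStep γ x v + gradStep γ x w := by
  simp only [← gradStepL_apply, map_add]

/-- Since I - γxxᵀ is symmetric, a step of the iterate can be moved to the test vector. -/
lemma inner_gradStep (γ : ℝ) (x u v : EuclideanSpace ℝ (Fin d)) :
    inner ℝ u (gradStep γ x v) = inner ℝ (gradStep γ x u) v := by
  simp only [gradStep, inner_sub_right, inner_sub_left, real_inner_smul_left,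
    real_inner_smul_right, real_inner_comm x u]
  ring

lemma norm_gradStep_sq (γ : ℝ) (x v : EuclideanSpace ℝ (Fin d)) :
    ‖gradStep γ x v‖ ^ 2 =
      ‖v‖ ^ 2 - 2 * γ * inner ℝ x v ^ 2 + γ ^ 2 * (‖x‖ ^ 2 * inner ℝ x v ^ 2) := by
  rw [gradStep, norm_sub_sq_real, real_inner_smul_right, norm_smul, mul_pow, Real.norm_eq_abs,
    sq_abs, real_inner_comm v x]
  ring

variable {μ : Measure (EuclideanSpace ℝ (Fin d) × ℝ)} [IsProbabilityMeasure μ]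
  {H : Matrix (Fin d) (Fin d) ℝ} {θ : EuclideanSpace ℝ (Fin d)} {σ R γ : ℝ}

lemma IsLeastSquaresLaw.integrable_norm_gradStep_sq (hμ : IsLeastSquaresLaw μ H θ σ R)
    (v : EuclideanSpace ℝ (Fin d)) : Integrable (fun z => ‖gradStep γ z.1 v‖ ^ 2) μ := by
  simp only [norm_gradStep_sq]
  exact ((integrable_const _).sub ((hμ.integrable_inner_sq v).const_mul _)).add
    ((hμ.integrable_norm_inner_sq v).const_mul _)

/-- In the expanded square the linear term has mean -2γ‖v‖²_H, and the quadratic term at most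
γ²R²‖v‖²_H. -/
lemma IsLeastSquaresLaw.integral_norm_gradStep_sq_le (hμ : IsLeastSquaresLaw μ H θ σ R)
    (v : EuclideanSpace ℝ (Fin d)) :
    ∫ z, ‖gradStep γ z.1 v‖ ^ 2 ∂μ ≤ ‖v‖ ^ 2 - γ * (2 - γ * R ^ 2) * sqNorm H v := by
  have i1 := (hμ.integrable_inner_sq v).const_mul (2 * γ)
  have i2 := (hμ.integrable_norm_inner_sq v).const_mul (γ ^ 2)
  have i0 : Integrable (fun _ : EuclideanSpace ℝ (Fin d) × ℝ => ‖v‖ ^ 2) μ := integrable_const _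
  simp only [norm_gradStep_sq]
  have i01 : Integrable (fun z : EuclideanSpace ℝ (Fin d) × ℝ =>
      ‖v‖ ^ 2 - 2 * γ * inner ℝ z.1 v ^ 2) μ := i0.sub i1
  rw [integral_add i01 i2, integral_sub i0 i1, integral_const_mul, integral_const_mul,
    hμ.integral_inner_sq]
  have := mul_le_mul_of_nonneg_left (hμ.integral_norm_inner_sq_le v) (sq_nonneg γ)
  simp only [integral_const, probReal_univ, one_smul]
  linarith

/-- One noiseless step decreases the mean squared distance. -/
lemma IsLeastSquaresLaw.lintegral_norm_gradStep_sq_add_le (hμ : IsLeastSquaresLaw μ H θ σ R)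
    (hH : H.PosSemidef) (hγ : 0 ≤ γ * (2 - γ * R ^ 2)) (v : EuclideanSpace ℝ (Fin d)) :
    ∫⁻ z, ENNReal.ofReal (‖gradStep γ z.1 v‖ ^ 2) ∂μ +
      ENNReal.ofReal (γ * (2 - γ * R ^ 2) * sqNorm H v) ≤ ENNReal.ofReal (‖v‖ ^ 2) := by
  rw [← ofReal_integral_eq_lintegral_ofReal (hμ.integrable_norm_gradStep_sq v)
    (Filter.Eventually.of_forall fun _ => sq_nonneg _), ← ENNReal.ofReal_add
    (integral_nonneg fun _ => sq_nonneg _) (mul_nonneg hγ (sqNorm_nonneg hH v))]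
  exact ENNReal.ofReal_le_ofReal (by linarith [hμ.integral_norm_gradStep_sq_le (γ := γ) v])

end Step

/-! ### Mean excess along noiseless paths -/

section Excess

variable {d : ℕ}

/-- `excess γ H μ n v` is the mean of `‖w‖²_H`, where `w` is obtained from `v` by `n` noiseless
steps of stochastic gradient descent driven by independent draws from `μ`. -/
noncomputable def excess (γ : ℝ) (H : Matrix (Fin d) (Fin d) ℝ)
    (μ : Measure (EuclideanSpace ℝ (Fin d) × ℝ)) : ℕ → EuclideanSpace ℝ (Fin d) → ℝ≥0∞
  | 0, v => ENNReal.ofReal (sqNorm H v)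
  | n + 1, v => ∫⁻ z, excess γ H μ n (gradStep γ z.1 v) ∂μ

variable {μ : Measure (EuclideanSpace ℝ (Fin d) × ℝ)} [IsProbabilityMeasure μ]
  {H : Matrix (Fin d) (Fin d) ℝ} {θ : EuclideanSpace ℝ (Fin d)} {σ R γ : ℝ}

lemma measurable_excess (n : ℕ) : Measurable (excess γ H μ n) := by
  induction n with
  | zero => exact (continuous_sqNorm H).measurable.ennreal_ofReal
  | succ n ih =>
    exact Measurable.lintegral_prod_right'
      (f := fun p : EuclideanSpace ℝ (Fin d) × EuclideanSpace ℝ (Fin d) × ℝ =>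
        excess γ H μ n (gradStep γ p.2.1 p.1)) (ih.comp (by fun_prop))

/-- The decrease κ‖v‖²_H is at least ξ‖v‖², by the choice of the smallest eigenvalue. -/
lemma IsLeastSquaresLaw.lintegral_norm_gradStep_sq_le (hμ : IsLeastSquaresLaw μ H θ σ R)
    (hH : H.PosSemidef) (hγ : 0 ≤ γ * (2 - γ * R ^ 2)) (v : EuclideanSpace ℝ (Fin d)) :
    ∫⁻ z, ENNReal.ofReal (‖gradStep γ z.1 v‖ ^ 2) ∂μ ≤
      ENNReal.ofReal ((1 - xi γ R H) * ‖v‖ ^ 2) := by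
  rw [← ofReal_integral_eq_lintegral_ofReal (hμ.integrable_norm_gradStep_sq v)
    (Filter.Eventually.of_forall fun _ => sq_nonneg _)]
  apply ENNReal.ofReal_le_ofReal
  have h1 := hμ.integral_norm_gradStep_sq_le (γ := γ) v
  have h2 := mul_le_mul_of_nonneg_left (lambdaMin_mul_norm_sq_le hH.1 v) hγ
  rw [xi]
  linarith

/-- For a unit vector, which exists as d > 0, the mean square after one step is nonnegative and at
most 1 - ξ. -/
lemma IsLeastSquaresLaw.xi_le_one (hμ : IsLeastSquaresLaw μ H θ σ R) (hd : 0 < d)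
    (hH : H.PosSemidef) (hγ : 0 ≤ γ * (2 - γ * R ^ 2)) : xi γ R H ≤ 1 := by
  set v : EuclideanSpace ℝ (Fin d) := EuclideanSpace.single ⟨0, hd⟩ 1 with hv
  have h1 := hμ.integral_norm_gradStep_sq_le (γ := γ) v
  have h2 := mul_le_mul_of_nonneg_left (lambdaMin_mul_norm_sq_le hH.1 v) hγ
  have h3 : 0 ≤ ∫ z, ‖gradStep γ z.1 v‖ ^ 2 ∂μ := integral_nonneg fun _ => sq_nonneg _
  have h4 : ‖v‖ = 1 := by simp [hv]
  rw [h4] at h1 h2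
  rw [xi]
  linarith

/-- Each step pays for its excess by a decrease of the mean squared norm, so the initial squared
norm pays for all. The induction peels off the first step, as `excess` does. -/
lemma IsLeastSquaresLaw.mul_sum_excess_le (hμ : IsLeastSquaresLaw μ H θ σ R)
    (hH : H.PosSemidef) (hγ : 0 ≤ γ * (2 - γ * R ^ 2)) (n : ℕ) (v : EuclideanSpace ℝ (Fin d)) :
    ENNReal.ofReal (γ * (2 - γ * R ^ 2)) * ∑ j ∈ Finset.range n, excess γ H μ j v ≤
      ENNReal.ofReal (‖v‖ ^ 2) := by
  induction n generalizing v with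
  | zero => simp
  | succ n ih =>
    have hm : ∀ j, Measurable fun z : EuclideanSpace ℝ (Fin d) × ℝ =>
        excess γ H μ j (gradStep γ z.1 v) := fun j => (measurable_excess j).comp (by fun_prop)
    rw [Finset.sum_range_succ', mul_add]
    refine le_trans ?_ (hμ.lintegral_norm_gradStep_sq_add_le hH hγ v)
    refine add_le_add ?_ ?_
    · simp only [excess]
      rw [← lintegral_finsetSum _ fun j _ => hm j, ← lintegral_const_mul _
        (Finset.measurable_fun_sum _ fun j _ => hm j)]
      exact lintegral_mono fun z => ih _
    · rw [excess, ENNReal.ofReal_mul hγ]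

/-- The first s steps contract the mean squared norm by ρ^s; the remaining steps then telescope. -/
lemma IsLeastSquaresLaw.mul_sum_excess_add_le (hμ : IsLeastSquaresLaw μ H θ σ R) (hd : 0 < d)
    (hH : H.PosSemidef) (hγ : 0 ≤ γ * (2 - γ * R ^ 2)) (s n : ℕ)
    (v : EuclideanSpace ℝ (Fin d)) :
    ENNReal.ofReal (γ * (2 - γ * R ^ 2)) * ∑ j ∈ Finset.range n, excess γ H μ (s + j) v ≤
      ENNReal.ofReal ((1 - xi γ R H) ^ s * ‖v‖ ^ 2) := by
  have hρ : 0 ≤ 1 - xi γ R H := sub_nonneg.2 (hμ.xi_le_one hd hH hγ)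
  induction s generalizing v with
  | zero => simpa using hμ.mul_sum_excess_le hH hγ n v
  | succ s ih =>
    have hm : ∀ j, Measurable fun z : EuclideanSpace ℝ (Fin d) × ℝ =>
        excess γ H μ (s + j) (gradStep γ z.1 v) := fun j =>
      (measurable_excess _).comp (by fun_prop)
    simp only [Nat.add_right_comm s 1, excess]
    rw [← lintegral_finsetSum _ fun j _ => hm j, ← lintegral_const_mul _
      (Finset.measurable_fun_sum _ fun j _ => hm j)]
    refine (lintegral_mono fun z => ih _).trans ?_
    simp only [ENNReal.ofReal_mul (pow_nonneg hρ s)]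
    rw [lintegral_const_mul _ (by fun_prop), pow_succ, mul_assoc,
      ENNReal.ofReal_mul (pow_nonneg hρ s)]
    gcongr
    exact hμ.lintegral_norm_gradStep_sq_le hH hγ v

/-- If the second moments of `V` in all directions are at most `a`, then the mean of a positive
quadratic form at `V` is at most `a` times its trace. -/
lemma lintegral_excess_le {Ω : Type*} [MeasurableSpace Ω] {P : Measure Ω} [SFinite P]
    (hH : H.PosSemidef) {a : ℝ} (ha : 0 ≤ a) {V : Ω → EuclideanSpace ℝ (Fin d)}
    (hV : Measurable V)
    (h : ∀ u, ∫⁻ ω, ENNReal.ofReal (inner ℝ u (V ω) ^ 2) ∂P ≤ ENNReal.ofReal (a * ‖u‖ ^ 2))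
    (n : ℕ) (L : EuclideanSpace ℝ (Fin d) →L[ℝ] EuclideanSpace ℝ (Fin d)) :
    ∫⁻ ω, excess γ H μ n (L (V ω)) ∂P ≤
      ENNReal.ofReal a * ∑ i, excess γ H μ n (L (EuclideanSpace.basisFun (Fin d) ℝ i)) := by
  induction n generalizing L with
  | zero =>
    obtain ⟨g, hg⟩ := exists_sqNorm_eq_sum_sq hH
    simp only [excess, hg]
    simp only [ENNReal.ofReal_sum_of_nonneg fun i _ => sq_nonneg (_ : ℝ)]
    rw [lintegral_finsetSum _ fun j _ => by fun_prop, Finset.sum_comm, Finset.mul_sum]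
    refine Finset.sum_le_sum fun k _ => ?_
    -- With the adjoint of L on the test vector g_k, the directional hypothesis applies, and
    -- Parseval turns the squared norm into a sum over the basis.
    simp only [← ContinuousLinearMap.adjoint_inner_left]
    refine (h _).trans (le_of_eq ?_)
    rw [ENNReal.ofReal_mul ha, ← ENNReal.ofReal_sum_of_nonneg fun i _ => sq_nonneg (_ : ℝ),
      ← (EuclideanSpace.basisFun (Fin d) ℝ).sum_sq_norm_inner_left]
    simp only [Real.norm_eq_abs, sq_abs]
  | succ n ih =>
    simp only [excess]
    rw [lintegral_lintegral_swap]
    -- For frozen z the step is linear and is absorbed into L; this is why the induction runs over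
    -- all L.
    · simp only [← gradStepL_apply, ← ContinuousLinearMap.comp_apply]
      refine (lintegral_mono fun z => ih _).trans ?_
      have hm : ∀ w, Measurable fun z : EuclideanSpace ℝ (Fin d) × ℝ =>
          excess γ H μ n ((gradStepL γ z.1).comp L w) := fun w => by
        simp only [ContinuousLinearMap.comp_apply, gradStepL_apply]
        exact (measurable_excess _).comp (by fun_prop)
      rw [lintegral_const_mul _ (Finset.measurable_fun_sum _ fun j _ => hm _),
        lintegral_finsetSum _ fun j _ => hm _]
    · exact ((measurable_excess n).comp (by fun_prop)).aemeasurable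

end Excess

/-! ### Decomposition of the error into bias and noise -/

section Path

variable {d : ℕ}

/-- The iterates of the noiseless steps, started at time `m` from `v`. -/
noncomputable def homPath (γ : ℝ) (z : ℤ → EuclideanSpace ℝ (Fin d) × ℝ) (m : ℤ)
    (v : EuclideanSpace ℝ (Fin d)) : ℕ → EuclideanSpace ℝ (Fin d)
  | 0 => v
  | n + 1 => gradStep γ (z (m + n)).1 (homPath γ z m v n)

/-- The error `θ_{m:m+n} - θ` of stochastic gradient descent started at time `m` from `θ`. -/
noncomputable def noisePath (γ : ℝ) (θ : EuclideanSpace ℝ (Fin d))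
    (z : ℤ → EuclideanSpace ℝ (Fin d) × ℝ) (m : ℤ) : ℕ → EuclideanSpace ℝ (Fin d)
  | 0 => 0
  | n + 1 => gradStep γ (z (m + n)).1 (noisePath γ θ z m n) +
      (γ * ((z (m + n)).2 - inner ℝ (z (m + n)).1 θ)) • (z (m + n)).1

lemma sgdSteps_sub (γ : ℝ) (θ₀ θ : EuclideanSpace ℝ (Fin d))
    (z : ℤ → EuclideanSpace ℝ (Fin d) × ℝ) (m : ℤ) (n : ℕ) :
    sgdSteps γ θ₀ (fun t => (z t).1) (fun t => (z t).2) m n - θ =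
      homPath γ z m (θ₀ - θ) n + noisePath γ θ z m n := by
  induction n with
  | zero => simp [sgdSteps, homPath, noisePath]
  | succ n ih =>
    have h := eq_add_of_sub_eq ih
    simp only [sgdSteps, homPath, noisePath]
    rw [← add_assoc, ← gradStep_add, h, gradStep]
    generalize homPath γ z m (θ₀ - θ) n + noisePath γ θ z m n = v
    rw [inner_add_right]
    module

/-- By linearity, noise accumulated before a restart evolves without further noise. Hence in the
difference of two coupled runs the common fresh noise cancels. -/
lemma noisePath_add (γ : ℝ) (θ : EuclideanSpace ℝ (Fin d))
    (z : ℤ → EuclideanSpace ℝ (Fin d) × ℝ) (m : ℤ) (i n : ℕ) :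
    noisePath γ θ z m (i + n) =
      homPath γ z (m + i) (noisePath γ θ z m i) n + noisePath γ θ z (m + i) n := by
  induction n with
  | zero => simp [homPath, noisePath]
  | succ n ih =>
    rw [← add_assoc i n 1]
    simp only [homPath, noisePath]
    rw [ih, gradStep_add]
    push_cast
    rw [← add_assoc m, add_assoc]

end Path

/-! ### Second moments of random vectors -/

section Moments

variable {Ω : Type*} [MeasurableSpace Ω] {P : Measure Ω}

lemma integrable_of_lintegral_ofReal_le {f : Ω → ℝ} (hf : AEStronglyMeasurable f P)
    (h0 : ∀ ω, 0 ≤ f ω) {C : ℝ} (h : ∫⁻ ω, ENNReal.ofReal (f ω) ∂P ≤ ENNReal.ofReal C) :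
    Integrable f P :=
  (lintegral_ofReal_ne_top_iff_integrable hf (Filter.Eventually.of_forall h0)).1
    (ne_top_of_le_ne_top ENNReal.ofReal_ne_top h)

lemma integral_le_of_lintegral_ofReal_le {f : Ω → ℝ} (hf : AEStronglyMeasurable f P)
    (h0 : ∀ ω, 0 ≤ f ω) {C : ℝ} (hC : 0 ≤ C)
    (h : ∫⁻ ω, ENNReal.ofReal (f ω) ∂P ≤ ENNReal.ofReal C) : ∫ ω, f ω ∂P ≤ C := by
  rw [← ofReal_integral_eq_lintegral_ofReal (integrable_of_lintegral_ofReal_le hf h0 h)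
    (Filter.Eventually.of_forall h0)] at h
  exact (ENNReal.ofReal_le_ofReal_iff hC).1 h

/-- Jensen's inequality, from integrating 2⟨m, f⟩ - ‖m‖² ≤ ‖f‖² with m the mean of f. -/
lemma norm_integral_sq_le {E : Type*} [NormedAddCommGroup E] [InnerProductSpace ℝ E]
    [CompleteSpace E] [IsProbabilityMeasure P] {f : Ω → E} (hf : Integrable f P)
    (hf2 : Integrable (fun ω => ‖f ω‖ ^ 2) P) : ‖∫ ω, f ω ∂P‖ ^ 2 ≤ ∫ ω, ‖f ω‖ ^ 2 ∂P := by
  set m := ∫ ω, f ω ∂P with hm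
  have h1 : ∫ ω, inner ℝ m (f ω) ∂P = ‖m‖ ^ 2 := by
    rw [integral_inner hf, ← hm, real_inner_self_eq_norm_sq]
  have h2 : ∫ ω, 2 * inner ℝ m (f ω) - ‖m‖ ^ 2 ∂P ≤ ∫ ω, ‖f ω‖ ^ 2 ∂P := by
    refine integral_mono (((hf.const_inner m).const_mul 2).sub (integrable_const _)) hf2
      fun ω => ?_
    have := norm_sub_sq_real m (f ω)
    simp only
    nlinarith [sq_nonneg ‖m - f ω‖]
  rw [integral_sub ((hf.const_inner m).const_mul 2) (integrable_const _), integral_const_mul, h1]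
    at h2
  simp only [integral_const, probReal_univ, one_smul] at h2
  linarith

lemma memLp_two_of_inner {d : ℕ} {V : Ω → EuclideanSpace ℝ (Fin d)}
    (h : ∀ u, MemLp (fun ω => inner ℝ u (V ω)) 2 P) : MemLp V 2 P := by
  have e : V = fun ω => ∑ i, inner ℝ (EuclideanSpace.basisFun (Fin d) ℝ i) (V ω) •
      EuclideanSpace.basisFun (Fin d) ℝ i := by
    ext1 ω
    exact ((EuclideanSpace.basisFun (Fin d) ℝ).sum_repr' (V ω)).symm
  rw [e]
  exact memLp_finsetSum _ fun i _ => (ContinuousLinearMap.toSpanSingleton ℝ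
    (EuclideanSpace.basisFun (Fin d) ℝ i)).comp_memLp' (h _)

lemma memLp_two_of_lintegral_norm_sq_le {E : Type*} [NormedAddCommGroup E] {V : Ω → E}
    (hV : AEStronglyMeasurable V P) {C : ℝ}
    (h : ∫⁻ ω, ENNReal.ofReal (‖V ω‖ ^ 2) ∂P ≤ ENNReal.ofReal C) : MemLp V 2 P :=
  (memLp_two_iff_integrable_sq_norm hV).2
    (integrable_of_lintegral_ofReal_le (hV.norm.pow 2) (fun _ => sq_nonneg _) h)

end Moments

/-! ### The paths depend on the past only -/

section Adapted

variable {d : ℕ} {Ω : Type*}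

lemma measurable_homPath (γ : ℝ) (Z : ℤ → Ω → EuclideanSpace ℝ (Fin d) × ℝ) (m : ℤ)
    {V : Ω → EuclideanSpace ℝ (Fin d)} (hV : Measurable[past Z m] V) (n : ℕ) :
    Measurable[past Z (m + n)] fun ω => homPath γ (fun t => Z t ω) m (V ω) n := by
  induction n with
  | zero => exact hV.mono (past_mono Z (by simp)) le_rfl
  | succ n ih =>
    have h1 : m + (n : ℤ) < m + (n + 1 : ℕ) := by push_cast; omega
    exact measurable_gradStep γ (measurable_past Z h1).fst (ih.mono (past_mono Z h1.le) le_rfl)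

lemma measurable_noisePath (γ : ℝ) (θ : EuclideanSpace ℝ (Fin d))
    (Z : ℤ → Ω → EuclideanSpace ℝ (Fin d) × ℝ) (m : ℤ) (n : ℕ) :
    Measurable[past Z (m + n)] fun ω => noisePath γ θ (fun t => Z t ω) m n := by
  induction n with
  | zero => exact measurable_const
  | succ n ih =>
    have h1 : m + (n : ℤ) < m + (n + 1 : ℕ) := by push_cast; omega
    have h2 := measurable_past Z h1
    have h3 : Measurable fun z : EuclideanSpace ℝ (Fin d) × ℝ =>
      (γ * (z.2 - inner ℝ z.1 θ)) • z.1 := by fun_prop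
    exact (measurable_gradStep γ h2.fst (ih.mono (past_mono Z h1.le) le_rfl)).add (h3.comp h2)

end Adapted

/-! ### One step from a random vector independent of the new data -/

section Step

variable {d : ℕ} {Ω : Type*} [MeasurableSpace Ω] {P : Measure Ω}
  {H : Matrix (Fin d) (Fin d) ℝ} {θ : EuclideanSpace ℝ (Fin d)} {σ R γ : ℝ}
  {V : Ω → EuclideanSpace ℝ (Fin d)} {Z : Ω → EuclideanSpace ℝ (Fin d) × ℝ}

lemma lintegral_excess_gradStep [IsProbabilityMeasure P] (hV : Measurable V) (hZ : Measurable Z)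
    (h : IndepFun V Z P)
    (n : ℕ) : ∫⁻ ω, excess γ H (P.map Z) n (gradStep γ (Z ω).1 (V ω)) ∂P =
      ∫⁻ ω, excess γ H (P.map Z) (n + 1) (V ω) ∂P := by
  have : IsProbabilityMeasure (P.map Z) := Measure.isProbabilityMeasure_map hZ.aemeasurable
  exact lintegral_indepFun hV hZ h (g := fun v z => excess γ H (P.map Z) n (gradStep γ z.1 v))
    ((measurable_excess n).comp (by fun_prop))

lemma lintegral_norm_gradStep_sq_le [IsProbabilityMeasure P]
    (hμ : IsLeastSquaresLaw (P.map Z) H θ σ R) (hd : 0 < d) (hH : H.PosSemidef)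
    (hγ : 0 ≤ γ * (2 - γ * R ^ 2)) (hV : Measurable V) (hZ : Measurable Z)
    (h : IndepFun V Z P) :
    ∫⁻ ω, ENNReal.ofReal (‖gradStep γ (Z ω).1 (V ω)‖ ^ 2) ∂P ≤
      ENNReal.ofReal (1 - xi γ R H) * ∫⁻ ω, ENNReal.ofReal (‖V ω‖ ^ 2) ∂P := by
  have : IsProbabilityMeasure (P.map Z) := Measure.isProbabilityMeasure_map hZ.aemeasurable
  rw [lintegral_indepFun hV hZ h (g := fun v z => ENNReal.ofReal (‖gradStep γ z.1 v‖ ^ 2))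
    (by unfold Function.uncurry; fun_prop), ← lintegral_const_mul _ (by fun_prop)]
  refine lintegral_mono fun ω => ?_
  rw [← ENNReal.ofReal_mul (sub_nonneg.2 (hμ.xi_le_one hd hH hγ))]
  exact hμ.lintegral_norm_gradStep_sq_le hH hγ _

lemma integral_gradStep [IsProbabilityMeasure P] (hV : Measurable V) (hZ : Measurable Z) (h : IndepFun V Z P)
    (hint : Integrable V P) (hint' : Integrable (fun ω => gradStep γ (Z ω).1 (V ω)) P) :
    ∫ ω, gradStep γ (Z ω).1 (V ω) ∂P = ∫ z, gradStep γ z.1 (∫ ω, V ω ∂P) ∂(P.map Z) := by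
  rw [integral_indepFun_symm hV hZ h (g := fun v z => gradStep γ z.1 v)
    (Measurable.stronglyMeasurable (by unfold Function.uncurry; fun_prop)) hint']
  simp only [← gradStepL_apply]
  exact integral_congr_ae (Filter.Eventually.of_forall fun z =>
    ContinuousLinearMap.integral_comp_comm _ hint)

/-- The directional second moments of `V` are at most `a`, and `V` is centered. -/
def CenteredWithMomentLE (P : Measure Ω) (a : ℝ) (V : Ω → EuclideanSpace ℝ (Fin d)) : Prop :=
  ∀ u, ∫⁻ ω, ENNReal.ofReal (inner ℝ u (V ω) ^ 2) ∂P ≤ ENNReal.ofReal (a * ‖u‖ ^ 2) ∧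
    ∫ ω, inner ℝ u (V ω) ∂P = 0

lemma CenteredWithMomentLE.memLp {a : ℝ} (h : CenteredWithMomentLE P a V) (hV : Measurable V) :
    MemLp V 2 P :=
  memLp_two_of_inner fun u => memLp_two_of_lintegral_norm_sq_le (C := a * ‖u‖ ^ 2)
    (by fun_prop) (by simpa only [Real.norm_eq_abs, sq_abs] using (h u).1)

/-- The step shrinks the old moment in direction u by at least aκ‖u‖²_H, and fresh noise adds at
most γ²σ²‖u‖²_H. The condition on a says that the loss covers the gain. -/
lemma CenteredWithMomentLE.gradStep_add [IsProbabilityMeasure P] {a : ℝ} (ha : 0 ≤ a)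
    (haγ : γ ^ 2 * σ ^ 2 ≤ a * (γ * (2 - γ * R ^ 2))) (hμ : IsLeastSquaresLaw (P.map Z) H θ σ R)
    (hH : H.PosSemidef) (hVc : CenteredWithMomentLE P a V) (hV : Measurable V)
    (hZ : Measurable Z) (h : IndepFun V Z P) :
    CenteredWithMomentLE P a fun ω =>
      gradStep γ (Z ω).1 (V ω) + (γ * ((Z ω).2 - inner ℝ (Z ω).1 θ)) • (Z ω).1 := by
  have : IsProbabilityMeasure (P.map Z) := Measure.isProbabilityMeasure_map hZ.aemeasurable
  intro u
  -- p is the propagated old noise, r the fresh noise, both in direction u.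
  set p : Ω → ℝ := fun ω => inner ℝ (gradStep γ (Z ω).1 u) (V ω) with hp
  set r : Ω → ℝ := fun ω => γ * (((Z ω).2 - inner ℝ (Z ω).1 θ) * inner ℝ (Z ω).1 u) with hr
  have hpm : Measurable p := by fun_prop
  have hrm : Measurable r := by fun_prop
  have hpr : ∀ ω, inner ℝ u (gradStep γ (Z ω).1 (V ω) +
      (γ * ((Z ω).2 - inner ℝ (Z ω).1 θ)) • (Z ω).1) = p ω + r ω := by
    intro ω
    rw [inner_add_right, inner_gradStep, real_inner_smul_right, real_inner_comm (Z ω).1 u, hp, hr]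
    ring
  simp only [hpr]
  have hgi := hμ.integrable_norm_gradStep_sq (γ := γ) u
  have hgl := hμ.integral_norm_gradStep_sq_le (γ := γ) u
  have hg0 : 0 ≤ ∫ z, ‖gradStep γ z.1 u‖ ^ 2 ∂(P.map Z) := integral_nonneg fun _ => sq_nonneg _
  have hp2 : ∫⁻ ω, ENNReal.ofReal (p ω ^ 2) ∂P ≤
      ENNReal.ofReal (a * ∫ z, ‖gradStep γ z.1 u‖ ^ 2 ∂(P.map Z)) := by
    rw [lintegral_indepFun_symm hV hZ h
      (g := fun v z => ENNReal.ofReal (inner ℝ (gradStep γ z.1 u) v ^ 2))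
      (by unfold Function.uncurry; fun_prop)]
    refine (lintegral_mono fun z => (hVc _).1).trans ?_
    rw [← integral_const_mul, ofReal_integral_eq_lintegral_ofReal (hgi.const_mul a)
      (Filter.Eventually.of_forall fun _ => mul_nonneg ha (sq_nonneg _))]
  have hpL : MemLp p 2 P := memLp_two_of_lintegral_norm_sq_le hpm.aestronglyMeasurable
    (by simpa only [Real.norm_eq_abs, sq_abs] using hp2)
  have hpi := integral_le_of_lintegral_ofReal_le (f := fun ω => p ω ^ 2)
    (hpm.pow_const 2).aestronglyMeasurable (fun _ => sq_nonneg _) (mul_nonneg ha hg0) hp2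
  have hri : Integrable (fun ω => r ω ^ 2) P := by
    have := ((hμ.integrable_resid_inner_sq u).comp_measurable hZ).const_mul (γ ^ 2)
    refine this.congr (Filter.Eventually.of_forall fun ω => ?_)
    simp only [hr, Function.comp]
    ring
  have hrL : MemLp r 2 P := (memLp_two_iff_integrable_sq hrm.aestronglyMeasurable).2 hri
  have hr2 : ∫ ω, r ω ^ 2 ∂P ≤ γ ^ 2 * (σ ^ 2 * sqNorm H u) := by
    have e : ∫ ω, r ω ^ 2 ∂P = γ ^ 2 *
        ∫ z, (z.2 - inner ℝ z.1 θ) ^ 2 * inner ℝ z.1 u ^ 2 ∂(P.map Z) := by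
      rw [integral_map hZ.aemeasurable (by fun_prop), ← integral_const_mul]
      refine integral_congr_ae (Filter.Eventually.of_forall fun ω => ?_)
      simp only [hr]
      ring
    rw [e]
    exact mul_le_mul_of_nonneg_left (hμ.integral_resid_inner_sq_le u) (sq_nonneg γ)
  have hr1 : ∫ ω, r ω ∂P = 0 := by
    have := hμ.integral_resid_inner u
    rw [integral_map hZ.aemeasurable (by fun_prop)] at this
    simp only [hr]
    rw [integral_const_mul, this, mul_zero]
  have hpri : Integrable (fun ω => p ω * r ω) P := hpL.integrable_mul hrL
  -- No cross term: with the new data frozen, r is constant and p is linear in the centered V.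
  have hpr0 : ∫ ω, p ω * r ω ∂P = 0 := by
    have hm : StronglyMeasurable (Function.uncurry fun (v : EuclideanSpace ℝ (Fin d))
        (z : EuclideanSpace ℝ (Fin d) × ℝ) => inner ℝ (gradStep γ z.1 u) v *
          (γ * ((z.2 - inner ℝ z.1 θ) * inner ℝ z.1 u))) :=
      Measurable.stronglyMeasurable (by unfold Function.uncurry; fun_prop)
    refine (integral_indepFun_symm hV hZ h hm hpri).trans ?_
    simp only [integral_mul_const, (hVc _).2, zero_mul, integral_zero]
  have hp0 : ∫ ω, p ω ∂P = 0 := by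
    have hm : StronglyMeasurable (Function.uncurry fun (v : EuclideanSpace ℝ (Fin d))
        (z : EuclideanSpace ℝ (Fin d) × ℝ) => inner ℝ (gradStep γ z.1 u) v) :=
      Measurable.stronglyMeasurable (by unfold Function.uncurry; fun_prop)
    refine (integral_indepFun_symm hV hZ h hm (hpL.integrable one_le_two)).trans ?_
    simp only [(hVc _).2, integral_zero]
  refine ⟨?_, ?_⟩
  · have i1 : Integrable (fun ω => p ω ^ 2 + 2 * (p ω * r ω)) P :=
      hpL.integrable_sq.add (hpri.const_mul 2)
    have e : ∫ ω, (p ω + r ω) ^ 2 ∂P = ∫ ω, p ω ^ 2 ∂P + ∫ ω, r ω ^ 2 ∂P := by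
      have : ∀ ω, (p ω + r ω) ^ 2 = p ω ^ 2 + 2 * (p ω * r ω) + r ω ^ 2 := fun ω => by ring
      simp only [this]
      rw [integral_add i1 hri, integral_add hpL.integrable_sq (hpri.const_mul 2),
        integral_const_mul, hpr0]
      ring
    have hs : Integrable (fun ω => (p ω + r ω) ^ 2) P := (hpL.add hrL).integrable_sq
    rw [← ofReal_integral_eq_lintegral_ofReal hs
      (Filter.Eventually.of_forall fun _ => sq_nonneg _)]
    apply ENNReal.ofReal_le_ofReal
    refine e.le.trans ?_
    have h1 := mul_le_mul_of_nonneg_left hgl ha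
    have h2 := mul_le_mul_of_nonneg_right haγ (sqNorm_nonneg hH u)
    nlinarith
  · rw [integral_add (hpL.integrable one_le_two) (hrL.integrable one_le_two), hp0, hr1, add_zero]

end Step

/-! ### The mean of a step and its iterates -/

section MeanStep

variable {d : ℕ}

/-- The mean of a noiseless step from `v`. -/
noncomputable def meanStep (γ : ℝ) (μ : Measure (EuclideanSpace ℝ (Fin d) × ℝ))
    (v : EuclideanSpace ℝ (Fin d)) : EuclideanSpace ℝ (Fin d) :=
  ∫ z, gradStep γ z.1 v ∂μ

variable {μ : Measure (EuclideanSpace ℝ (Fin d) × ℝ)} [IsProbabilityMeasure μ]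
  {H : Matrix (Fin d) (Fin d) ℝ} {θ : EuclideanSpace ℝ (Fin d)} {σ R γ : ℝ}

lemma IsLeastSquaresLaw.norm_meanStep_sq_le (hμ : IsLeastSquaresLaw μ H θ σ R)
    (hH : H.PosSemidef) (hγ : 0 ≤ γ * (2 - γ * R ^ 2)) (v : EuclideanSpace ℝ (Fin d)) :
    ‖meanStep γ μ v‖ ^ 2 ≤ (1 - xi γ R H) * ‖v‖ ^ 2 := by
  have hL : MemLp (fun z : EuclideanSpace ℝ (Fin d) × ℝ => gradStep γ z.1 v) 2 μ :=
    (memLp_two_iff_integrable_sq_norm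
      (measurable_gradStep γ measurable_fst measurable_const).aestronglyMeasurable).2
        (hμ.integrable_norm_gradStep_sq v)
  have h1 := norm_integral_sq_le (hL.integrable one_le_two) (hμ.integrable_norm_gradStep_sq v)
  have h2 := hμ.integral_norm_gradStep_sq_le (γ := γ) v
  have h3 := mul_le_mul_of_nonneg_left (lambdaMin_mul_norm_sq_le hH.1 v) hγ
  rw [meanStep, xi]
  linarith

lemma IsLeastSquaresLaw.norm_iterate_meanStep_sq_le (hμ : IsLeastSquaresLaw μ H θ σ R)
    (hd : 0 < d) (hH : H.PosSemidef) (hγ : 0 ≤ γ * (2 - γ * R ^ 2)) (n : ℕ)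
    (v : EuclideanSpace ℝ (Fin d)) :
    ‖(meanStep γ μ)^[n] v‖ ^ 2 ≤ (1 - xi γ R H) ^ n * ‖v‖ ^ 2 := by
  induction n with
  | zero => simp
  | succ n ih =>
    rw [Function.iterate_succ_apply', pow_succ' (1 - xi γ R H)]
    have := mul_le_mul_of_nonneg_left ih (sub_nonneg.2 (hμ.xi_le_one hd hH hγ))
    linarith [hμ.norm_meanStep_sq_le hH hγ ((meanStep γ μ)^[n] v)]

lemma IsLeastSquaresLaw.tendsto_iterate_meanStep (hμ : IsLeastSquaresLaw μ H θ σ R)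
    (hd : 0 < d) (hH : H.PosSemidef) (hγ : 0 ≤ γ * (2 - γ * R ^ 2)) (hξ : 0 < xi γ R H)
    (v : EuclideanSpace ℝ (Fin d)) :
    Filter.Tendsto (fun n => (meanStep γ μ)^[n] v) Filter.atTop (nhds 0) := by
  have h1 : Filter.Tendsto (fun n : ℕ => (1 - xi γ R H) ^ n * ‖v‖ ^ 2) Filter.atTop (nhds 0) := by
    simpa using (tendsto_pow_atTop_nhds_zero_of_lt_one
      (sub_nonneg.2 (hμ.xi_le_one hd hH hγ)) (by linarith)).mul_const (‖v‖ ^ 2)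
  have h2 := squeeze_zero (fun n => sq_nonneg _)
    (fun n => hμ.norm_iterate_meanStep_sq_le hd hH hγ n v) h1
  have h3 := (Real.continuous_sqrt.tendsto 0).comp h2
  rw [tendsto_zero_iff_norm_tendsto_zero]
  simpa [Function.comp_def, Real.sqrt_sq (norm_nonneg _)] using h3

end MeanStep

/-! ### Moments of the bias and noise paths -/

section Path

variable {d : ℕ} {Ω : Type*} [MeasurableSpace Ω] {P : Measure Ω} [IsProbabilityMeasure P]
  {μ : Measure (EuclideanSpace ℝ (Fin d) × ℝ)}
  {H : Matrix (Fin d) (Fin d) ℝ} {θ θ₀ : EuclideanSpace ℝ (Fin d)} {σ R γ : ℝ}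
  {Z : ℤ → Ω → EuclideanSpace ℝ (Fin d) × ℝ}

/-- New data are independent of the past, so each actual step can be traded for one more averaged
step in `excess`. -/
lemma lintegral_excess_homPath (hZ : ∀ t, Measurable (Z t)) (hi : iIndepFun Z P)
    (hlaw : ∀ t, P.map (Z t) = μ) (m : ℤ) {V : Ω → EuclideanSpace ℝ (Fin d)}
    (hV : Measurable[past Z m] V) (n j : ℕ) :
    ∫⁻ ω, excess γ H μ j (homPath γ (fun t => Z t ω) m (V ω) n) ∂P =
      ∫⁻ ω, excess γ H μ (n + j) (V ω) ∂P := by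
  induction n generalizing j with
  | zero => simp [homPath]
  | succ n ih =>
    have h1 := measurable_homPath γ Z m hV n
    have h2 := lintegral_excess_gradStep (γ := γ) (H := H) (h1.mono (past_le hZ _) le_rfl)
      (hZ (m + n)) (indepFun_of_past hZ hi h1) j
    rw [hlaw] at h2
    simp only [homPath]
    rw [h2, ih, Nat.add_right_comm, Nat.add_assoc]

lemma lintegral_norm_homPath_sq_le (hμ : IsLeastSquaresLaw μ H θ σ R) (hd : 0 < d)
    (hH : H.PosSemidef) (hγ : 0 ≤ γ * (2 - γ * R ^ 2)) (hZ : ∀ t, Measurable (Z t))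
    (hi : iIndepFun Z P) (hlaw : ∀ t, P.map (Z t) = μ) (m : ℤ) (v : EuclideanSpace ℝ (Fin d))
    (n : ℕ) : ∫⁻ ω, ENNReal.ofReal (‖homPath γ (fun t => Z t ω) m v n‖ ^ 2) ∂P ≤
      ENNReal.ofReal ((1 - xi γ R H) ^ n * ‖v‖ ^ 2) := by
  have : IsProbabilityMeasure μ := hlaw 0 ▸ Measure.isProbabilityMeasure_map (hZ 0).aemeasurable
  have hρ := sub_nonneg.2 (hμ.xi_le_one hd hH hγ)
  induction n with
  | zero => simp [homPath]
  | succ n ih =>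
    have h1 := measurable_homPath γ Z m (V := fun _ => v) measurable_const n
    have h2 := lintegral_norm_gradStep_sq_le (P := P) (Z := Z (m + n)) (by rwa [hlaw]) hd hH hγ
      (h1.mono (past_le hZ _) le_rfl) (hZ (m + n)) (indepFun_of_past hZ hi h1)
    refine h2.trans ?_
    rw [pow_succ', mul_assoc, ENNReal.ofReal_mul hρ]
    gcongr

lemma memLp_homPath (hμ : IsLeastSquaresLaw μ H θ σ R) (hd : 0 < d)
    (hH : H.PosSemidef) (hγ : 0 ≤ γ * (2 - γ * R ^ 2)) (hZ : ∀ t, Measurable (Z t))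
    (hi : iIndepFun Z P) (hlaw : ∀ t, P.map (Z t) = μ) (m : ℤ) (v : EuclideanSpace ℝ (Fin d))
    (n : ℕ) : MemLp (fun ω => homPath γ (fun t => Z t ω) m v n) 2 P :=
  memLp_two_of_lintegral_norm_sq_le
    ((measurable_homPath γ Z m (V := fun _ => v) measurable_const n).mono
      (past_le hZ _) le_rfl).aestronglyMeasurable
    (lintegral_norm_homPath_sq_le hμ hd hH hγ hZ hi hlaw m v n)

lemma integral_homPath (hμ : IsLeastSquaresLaw μ H θ σ R) (hd : 0 < d)
    (hH : H.PosSemidef) (hγ : 0 ≤ γ * (2 - γ * R ^ 2)) (hZ : ∀ t, Measurable (Z t))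
    (hi : iIndepFun Z P) (hlaw : ∀ t, P.map (Z t) = μ) (m : ℤ) (v : EuclideanSpace ℝ (Fin d))
    (n : ℕ) : ∫ ω, homPath γ (fun t => Z t ω) m v n ∂P = (meanStep γ μ)^[n] v := by
  induction n with
  | zero => simp [homPath]
  | succ n ih =>
    have h1 := measurable_homPath γ Z m (V := fun _ => v) measurable_const n
    have hL := fun n => (memLp_homPath hμ hd hH hγ hZ hi hlaw m v n).integrable one_le_two
    have h2 := integral_gradStep (P := P) (γ := γ) (h1.mono (past_le hZ _) le_rfl) (hZ (m + n))
      (indepFun_of_past hZ hi h1) (hL n) (hL (n + 1))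
    rw [Function.iterate_succ_apply', ← ih, meanStep, ← hlaw (m + n)]
    exact h2

lemma centeredWithMomentLE_noisePath (hμ : IsLeastSquaresLaw μ H θ σ R) (hH : H.PosSemidef)
    {a : ℝ} (ha : 0 ≤ a) (haγ : γ ^ 2 * σ ^ 2 ≤ a * (γ * (2 - γ * R ^ 2)))
    (hZ : ∀ t, Measurable (Z t)) (hi : iIndepFun Z P) (hlaw : ∀ t, P.map (Z t) = μ) (m : ℤ)
    (n : ℕ) : CenteredWithMomentLE P a fun ω => noisePath γ θ (fun t => Z t ω) m n := by
  induction n with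
  | zero => intro u; simp [noisePath]
  | succ n ih =>
    have h1 := measurable_noisePath γ θ Z m n
    exact ih.gradStep_add ha haγ (Z := Z (m + n)) (by rwa [hlaw]) hH
      (h1.mono (past_le hZ _) le_rfl) (hZ _) (indepFun_of_past hZ hi h1)

lemma memLp_noisePath (hμ : IsLeastSquaresLaw μ H θ σ R) (hH : H.PosSemidef)
    {a : ℝ} (ha : 0 ≤ a) (haγ : γ ^ 2 * σ ^ 2 ≤ a * (γ * (2 - γ * R ^ 2)))
    (hZ : ∀ t, Measurable (Z t)) (hi : iIndepFun Z P) (hlaw : ∀ t, P.map (Z t) = μ) (m : ℤ)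
    (n : ℕ) : MemLp (fun ω => noisePath γ θ (fun t => Z t ω) m n) 2 P :=
  (centeredWithMomentLE_noisePath hμ hH ha haγ hZ hi hlaw m n).memLp
    ((measurable_noisePath γ θ Z m n).mono (past_le hZ _) le_rfl)

lemma integral_noisePath (hμ : IsLeastSquaresLaw μ H θ σ R) (hH : H.PosSemidef)
    {a : ℝ} (ha : 0 ≤ a) (haγ : γ ^ 2 * σ ^ 2 ≤ a * (γ * (2 - γ * R ^ 2)))
    (hZ : ∀ t, Measurable (Z t)) (hi : iIndepFun Z P) (hlaw : ∀ t, P.map (Z t) = μ) (m : ℤ)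
    (n : ℕ) : ∫ ω, noisePath γ θ (fun t => Z t ω) m n ∂P = 0 := by
  refine ext_inner_left ℝ fun u => ?_
  rw [← integral_inner
    ((memLp_noisePath hμ hH ha haγ hZ hi hlaw m n).integrable one_le_two), inner_zero_right]
  exact (centeredWithMomentLE_noisePath hμ hH ha haγ hZ hi hlaw m n u).2

lemma sgdSteps_eq (γ : ℝ) (θ₀ θ : EuclideanSpace ℝ (Fin d))
    (z : ℤ → EuclideanSpace ℝ (Fin d) × ℝ) (m : ℤ) (n : ℕ) :
    sgdSteps γ θ₀ (fun t => (z t).1) (fun t => (z t).2) m n =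
      homPath γ z m (θ₀ - θ) n + noisePath γ θ z m n + θ :=
  eq_add_of_sub_eq (sgdSteps_sub γ θ₀ θ z m n)

lemma memLp_sgdSteps (hμ : IsLeastSquaresLaw μ H θ σ R) (hd : 0 < d) (hH : H.PosSemidef)
    {a : ℝ} (ha : 0 ≤ a) (haγ : γ ^ 2 * σ ^ 2 ≤ a * (γ * (2 - γ * R ^ 2)))
    (hγ : 0 ≤ γ * (2 - γ * R ^ 2)) (hZ : ∀ t, Measurable (Z t)) (hi : iIndepFun Z P)
    (hlaw : ∀ t, P.map (Z t) = μ) (m : ℤ) (n : ℕ) :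
    MemLp (fun ω => sgdSteps γ θ₀ (fun t => (Z t ω).1) (fun t => (Z t ω).2) m n) 2 P := by
  simp only [fun ω => sgdSteps_eq γ θ₀ θ (fun t => Z t ω) m n]
  exact ((memLp_homPath hμ hd hH hγ hZ hi hlaw m _ n).add
    (memLp_noisePath hμ hH ha haγ hZ hi hlaw m n)).add (memLp_const θ)

lemma integral_sgdSteps (hμ : IsLeastSquaresLaw μ H θ σ R) (hd : 0 < d) (hH : H.PosSemidef)
    {a : ℝ} (ha : 0 ≤ a) (haγ : γ ^ 2 * σ ^ 2 ≤ a * (γ * (2 - γ * R ^ 2)))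
    (hγ : 0 ≤ γ * (2 - γ * R ^ 2)) (hZ : ∀ t, Measurable (Z t)) (hi : iIndepFun Z P)
    (hlaw : ∀ t, P.map (Z t) = μ) (m : ℤ) (n : ℕ) :
    ∫ ω, sgdSteps γ θ₀ (fun t => (Z t ω).1) (fun t => (Z t ω).2) m n ∂P =
      (meanStep γ μ)^[n] (θ₀ - θ) + θ := by
  simp only [fun ω => sgdSteps_eq γ θ₀ θ (fun t => Z t ω) m n]
  have i1 := (memLp_homPath hμ hd hH hγ hZ hi hlaw m (θ₀ - θ) n).integrable one_le_two
  have i2 := (memLp_noisePath hμ hH ha haγ hZ hi hlaw m n).integrable one_le_two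
  have i12 : Integrable (fun ω => homPath γ (fun t => Z t ω) m (θ₀ - θ) n +
    noisePath γ θ (fun t => Z t ω) m n) P := i1.add i2
  rw [integral_add i12 (integrable_const θ), integral_add i1 i2,
    integral_homPath hμ hd hH hγ hZ hi hlaw, integral_noisePath hμ hH ha haγ hZ hi hlaw]
  simp

/-- The mean squared distance of two coupled iterates. -/
lemma lintegral_sqNorm_sgdSteps_sub_le (hμ : IsLeastSquaresLaw μ H θ σ R) (hH : H.PosSemidef)
    {a : ℝ} (ha : 0 ≤ a) (haγ : γ ^ 2 * σ ^ 2 ≤ a * (γ * (2 - γ * R ^ 2)))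
    (hZ : ∀ t, Measurable (Z t)) (hi : iIndepFun Z P) (hlaw : ∀ t, P.map (Z t) = μ) (t : ℤ)
    (i n : ℕ) :
    ∫⁻ ω, ENNReal.ofReal (sqNorm H
      (sgdSteps γ θ₀ (fun t => (Z t ω).1) (fun t => (Z t ω).2) (t - (i + n : ℕ)) (i + n) -
        sgdSteps γ θ₀ (fun t => (Z t ω).1) (fun t => (Z t ω).2) (t - n) n)) ∂P ≤
      3 * (excess γ H μ (i + n) (θ₀ - θ) + excess γ H μ n (θ₀ - θ) +
        ENNReal.ofReal a * ∑ l, excess γ H μ n (EuclideanSpace.basisFun (Fin d) ℝ l)) := by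
  have hm : t - (i + n : ℕ) + (i : ℤ) = t - n := by push_cast; ring
  have hV := hm ▸ measurable_noisePath γ θ Z (t - (i + n : ℕ)) i
  have e0 : ∀ v : EuclideanSpace ℝ (Fin d), ENNReal.ofReal (sqNorm H v) = excess γ H μ 0 v :=
    fun _ => rfl
  have hme : Measurable (excess γ H μ 0) := (continuous_sqNorm H).measurable.ennreal_ofReal
  have m1 : ∀ (m : ℤ) (n : ℕ), Measurable fun ω => homPath γ (fun t => Z t ω) m (θ₀ - θ) n :=
    fun m n => (measurable_homPath γ Z m (V := fun _ => θ₀ - θ) measurable_const n).mono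
      (past_le hZ _) le_rfl
  have m2 : Measurable fun ω => homPath γ (fun t => Z t ω) (t - n)
      (noisePath γ θ (fun t => Z t ω) (t - (i + n : ℕ)) i) n :=
    (measurable_homPath γ Z (t - n) hV n).mono (past_le hZ _) le_rfl
  -- The difference has three parts: the two bias paths, and the older noise propagated without
  -- noise over the common n steps.
  have hpt : ∀ ω, ENNReal.ofReal (sqNorm H
      (sgdSteps γ θ₀ (fun t => (Z t ω).1) (fun t => (Z t ω).2) (t - (i + n : ℕ)) (i + n) -
        sgdSteps γ θ₀ (fun t => (Z t ω).1) (fun t => (Z t ω).2) (t - n) n)) ≤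
      3 * (excess γ H μ 0 (homPath γ (fun t => Z t ω) (t - (i + n : ℕ)) (θ₀ - θ) (i + n)) +
        excess γ H μ 0 (homPath γ (fun t => Z t ω) (t - n) (θ₀ - θ) n) +
        excess γ H μ 0 (homPath γ (fun t => Z t ω) (t - n)
          (noisePath γ θ (fun t => Z t ω) (t - (i + n : ℕ)) i) n)) := by
    intro ω
    rw [sgdSteps_eq γ θ₀ θ (fun t => Z t ω), sgdSteps_eq γ θ₀ θ (fun t => Z t ω) (t - n),
      noisePath_add, hm]
    simp only [← e0]
    rw [← ENNReal.ofReal_add (sqNorm_nonneg hH _) (sqNorm_nonneg hH _),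
      ← ENNReal.ofReal_add (add_nonneg (sqNorm_nonneg hH _) (sqNorm_nonneg hH _))
        (sqNorm_nonneg hH _), ← ENNReal.ofReal_ofNat 3, ← ENNReal.ofReal_mul (by norm_num)]
    apply ENNReal.ofReal_le_ofReal
    refine le_trans (le_of_eq ?_) (sqNorm_add_sub_le hH _ _ _)
    congr 1
    abel
  refine (lintegral_mono hpt).trans ?_
  have m3 := hme.comp m2
  have m4 := hme.comp (m1 (t - n) n)
  simp only [Function.comp_def] at m3 m4
  rw [lintegral_const_mul' _ _ (by norm_num), lintegral_add_right _ m3,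
    lintegral_add_right _ m4]
  gcongr
  · rw [lintegral_excess_homPath hZ hi hlaw _ (V := fun _ => θ₀ - θ) measurable_const]
    simp
  · rw [lintegral_excess_homPath hZ hi hlaw _ (V := fun _ => θ₀ - θ) measurable_const]
    simp
  · rw [lintegral_excess_homPath hZ hi hlaw _ hV]
    have : IsProbabilityMeasure μ :=
      hlaw 0 ▸ Measure.isProbabilityMeasure_map (hZ 0).aemeasurable
    exact lintegral_excess_le hH ha (hV.mono (past_le hZ _) le_rfl)
      (fun u => (centeredWithMomentLE_noisePath hμ hH ha haγ hZ hi hlaw _ _ u).1) (n + 0)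
      (ContinuousLinearMap.id ℝ _)

end Path

/-! ### Uniform laws and conditioning on a discrete variable -/

section Discrete

lemma lintegral_uniformOn (s : Finset ℕ) (f : ℕ → ℝ≥0∞) :
    ∫⁻ n, f n ∂(uniformOn (s : Set ℕ)) = (s.card : ℝ≥0∞)⁻¹ * ∑ n ∈ s, f n := by
  rw [uniformOn, ProbabilityTheory.cond, lintegral_smul_measure, lintegral_finset]
  simp

lemma integral_uniformOn {E : Type*} [NormedAddCommGroup E] [NormedSpace ℝ E] [CompleteSpace E]
    (s : Finset ℕ) (f : ℕ → E) :
    ∫ n, f n ∂(uniformOn (s : Set ℕ)) = (s.card : ℝ)⁻¹ • ∑ n ∈ s, f n := by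
  have : IsFiniteMeasure (Measure.count.restrict (s : Set ℕ)) := ⟨by simp⟩
  have hf : IntegrableOn f (s : Set ℕ) Measure.count := by
    -- Counting measure on `ℕ` is infinite; restricting twice puts the finite restricted measure in
    -- its place.
    rw [IntegrableOn, ← Measure.restrict_restrict_of_subset (subset_refl (s : Set ℕ))]
    exact IntegrableOn.finset
  rw [uniformOn, ProbabilityTheory.cond, integral_smul_measure, setIntegral_finset _ hf]
  simp

lemma ae_uniformOn_mem (s : Finset ℕ) : ∀ᵐ n ∂(uniformOn (s : Set ℕ)), n ∈ s := by
  have := ae_cond_mem (μ := Measure.count) (s := (s : Set ℕ)) s.measurableSet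
  simpa [uniformOn] using this

variable {Ω S T : Type*} [MeasurableSpace Ω] [MeasurableSpace S] [MeasurableSpace T]
  [Countable T] [MeasurableSingletonClass T] {P : Measure Ω} [IsProbabilityMeasure P]

lemma lintegral_indepFun_countable {U : Ω → T} {V : Ω → S} (hU : Measurable U)
    (hV : Measurable V) (h : IndepFun U V P) {g : T → S → ℝ≥0∞} (hg : ∀ u, Measurable (g u)) :
    ∫⁻ ω, g (U ω) (V ω) ∂P = ∫⁻ u, ∫⁻ ω, g u (V ω) ∂P ∂(P.map U) :=
  lintegral_indepFun_symm hV hU h.symm (g := fun v u => g u v)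
    (measurable_from_prod_countable_left fun u => hg u)

variable {E : Type*} [NormedAddCommGroup E] [NormedSpace ℝ E]
    [MeasurableSpace E] [BorelSpace E] [SecondCountableTopology E]

lemma integral_indepFun_countable {U : Ω → T} {V : Ω → S} (hU : Measurable U)
    (hV : Measurable V) (h : IndepFun U V P) {g : T → S → E} (hg : ∀ u, Measurable (g u))
    (hint : Integrable (fun ω => g (U ω) (V ω)) P) :
    ∫ ω, g (U ω) (V ω) ∂P = ∫ u, ∫ ω, g u (V ω) ∂P ∂(P.map U) :=
  integral_indepFun_symm hV hU h.symm (g := fun v u => g u v)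
    (measurable_from_prod_countable_left fun u => hg u).stronglyMeasurable hint

lemma hasSum_integral_indepFun [CompleteSpace E] {U : Ω → T} {V : Ω → S} (hU : Measurable U)
    (hV : Measurable V) (h : IndepFun U V P) {g : T → S → E} (hg : ∀ u, Measurable (g u))
    (hint : Integrable (fun ω => g (U ω) (V ω)) P) :
    HasSum (fun u => P.real (U ⁻¹' {u}) • ∫ ω, g u (V ω) ∂P) (∫ ω, g (U ω) (V ω) ∂P) := by
  have hm : Measurable (Function.uncurry fun (u : T) (v : S) => g u v) :=
    measurable_from_prod_countable_right fun u => hg u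
  have : IsProbabilityMeasure (P.map U) := Measure.isProbabilityMeasure_map hU.aemeasurable
  have : IsProbabilityMeasure (P.map V) := Measure.isProbabilityMeasure_map hV.aemeasurable
  have hi : Integrable (fun u => ∫ ω, g u (V ω) ∂P) (P.map U) := by
    have h1 : Integrable (Function.uncurry g) ((P.map U).prod (P.map V)) := by
      rw [← (indepFun_iff_map_prod_eq_prod_map_map hU.aemeasurable hV.aemeasurable).1 h,
        integrable_map_measure hm.aestronglyMeasurable (hU.prodMk hV).aemeasurable]
      exact hint
    refine h1.integral_prod_left.congr (Filter.Eventually.of_forall fun u => ?_)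
    exact integral_map hV.aemeasurable (hg u).aestronglyMeasurable
  rw [integral_indepFun_countable hU hV h hg hint]
  have hs : Measure.sum (fun t => P.map U {t} • Measure.dirac t) = P.map U :=
    Measure.sum_smul_dirac _
  have := hasSum_integral_measure (f := fun u => ∫ ω, g u (V ω) ∂P)
    (μ := fun t => P.map U {t} • Measure.dirac t) (by rwa [hs])
  rw [hs] at this
  simpa [integral_smul_measure, integral_dirac, Measure.real,
    Measure.map_apply hU (measurableSet_singleton _)] using this

end Discrete

/-! ### Coupled runs with random starts on consecutive ranges -/

section Coupling

variable {d : ℕ}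

/-- The iterate at time `0` of stochastic gradient descent started at time `-n`. -/
noncomputable def sgdEnd (γ : ℝ) (θ₀ : EuclideanSpace ℝ (Fin d)) (n : ℕ)
    (z : ℤ → EuclideanSpace ℝ (Fin d) × ℝ) : EuclideanSpace ℝ (Fin d) :=
  sgdSteps γ θ₀ (fun t => (z t).1) (fun t => (z t).2) (-n) n

lemma measurable_sgdSteps (γ : ℝ) (θ₀ : EuclideanSpace ℝ (Fin d)) (m : ℤ) (n : ℕ) :
    Measurable fun z : ℤ → EuclideanSpace ℝ (Fin d) × ℝ =>
      sgdSteps γ θ₀ (fun t => (z t).1) (fun t => (z t).2) m n := by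
  induction n with
  | zero => exact measurable_const
  | succ n ih =>
    simp only [sgdSteps]
    fun_prop

lemma measurable_sgdEnd (γ : ℝ) (θ₀ : EuclideanSpace ℝ (Fin d)) (n : ℕ) :
    Measurable (sgdEnd γ θ₀ n) :=
  measurable_sgdSteps γ θ₀ _ n

variable {Ω : Type*} [MeasurableSpace Ω] {P : Measure Ω} [IsProbabilityMeasure P]
  {μ : Measure (EuclideanSpace ℝ (Fin d) × ℝ)}
  {H : Matrix (Fin d) (Fin d) ℝ} {θ θ₀ : EuclideanSpace ℝ (Fin d)} {σ R γ : ℝ}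
  {Z : ℤ → Ω → EuclideanSpace ℝ (Fin d) × ℝ}

/-- A uniform start turns the bound on a sum of excesses into a bound on their average; its left end
point s acts as burn-in. -/
lemma IsLeastSquaresLaw.lintegral_excess_uniformOn_le [IsProbabilityMeasure μ]
    (hμ : IsLeastSquaresLaw μ H θ σ R) (hd : 0 < d)
    (hH : H.PosSemidef) (hγ : 0 < γ * (2 - γ * R ^ 2)) {s t : ℕ} (hst : s < t)
    (v : EuclideanSpace ℝ (Fin d)) :
    ∫⁻ n, excess γ H μ n v ∂(uniformOn (Finset.Ico s t : Set ℕ)) ≤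
      ENNReal.ofReal ((1 - xi γ R H) ^ s * ‖v‖ ^ 2 / (γ * (2 - γ * R ^ 2)) / (t - s)) := by
  have h := hμ.mul_sum_excess_add_le hd hH hγ.le s (t - s) v
  have hn : (0 : ℝ) < t - s := sub_pos.2 (by exact_mod_cast hst)
  rw [lintegral_uniformOn, Finset.sum_Ico_eq_sum_range, Nat.card_Ico,
    ENNReal.ofReal_div_of_pos hn, ENNReal.ofReal_div_of_pos hγ, mul_comm,
    ← ENNReal.div_eq_inv_mul.trans (mul_comm _ _)]
  have hc : ((t - s : ℕ) : ℝ≥0∞) = ENNReal.ofReal (t - s) := by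
    rw [← Nat.cast_sub hst.le, ENNReal.ofReal_natCast]
  rw [hc]
  gcongr
  rw [ENNReal.le_div_iff_mul_le (.inl (by simpa using hγ)) (.inl ENNReal.ofReal_ne_top), mul_comm]
  exact h

/-- The mean squared distance between the iterates at time `0` started at two random times, which
are uniformly distributed on consecutive intervals. -/
lemma lintegral_sqNorm_sgdEnd_sub_le (hμ : IsLeastSquaresLaw μ H θ σ R) (hd : 0 < d)
    (hH : H.PosSemidef) (hγ0 : 0 < γ) (hγ : 0 < 2 - γ * R ^ 2)
    (hZ : ∀ t, Measurable (Z t)) (hi : iIndepFun Z P) (hlaw : ∀ t, P.map (Z t) = μ)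
    {s t t' : ℕ} (hst : s < t) (htt' : t - s ≤ t' - t) {τ τ' : Ω → ℕ} (hτ : Measurable τ)
    (hτ' : Measurable τ') (hτlaw : P.map τ = uniformOn (Finset.Ico s t : Set ℕ))
    (hτlaw' : P.map τ' = uniformOn (Finset.Ico t t' : Set ℕ)) (hττ' : IndepFun τ τ' P)
    (hτZ : IndepFun (fun ω => (τ ω, τ' ω)) (fun ω t => Z t ω) P) :
    ∫⁻ ω, ENNReal.ofReal (sqNorm H
      (sgdEnd γ θ₀ (τ' ω) (fun t => Z t ω) - sgdEnd γ θ₀ (τ ω) (fun t => Z t ω))) ∂P ≤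
      ENNReal.ofReal (6 * cConst γ σ R θ₀ θ * (1 - xi γ R H) ^ s / (t - s)) := by
  have : IsProbabilityMeasure μ := hlaw 0 ▸ Measure.isProbabilityMeasure_map (hZ 0).aemeasurable
  have hκ : 0 < γ * (2 - γ * R ^ 2) := mul_pos hγ0 hγ
  have hρ := sub_nonneg.2 (hμ.xi_le_one hd hH hκ.le)
  -- The value at which loss and gain of the noise moment balance exactly.
  set a : ℝ := γ * σ ^ 2 / (2 - γ * R ^ 2) with ha_def
  have ha : 0 ≤ a := by positivity
  have haγ : γ ^ 2 * σ ^ 2 ≤ a * (γ * (2 - γ * R ^ 2)) := by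
    rw [ha_def]
    apply le_of_eq
    field_simp
  have hU : Measurable fun ω => (τ ω, τ' ω) := hτ.prodMk hτ'
  have hZm : Measurable fun ω t => Z t ω := measurable_pi_lambda _ hZ
  have hg : ∀ u : ℕ × ℕ, Measurable fun z => ENNReal.ofReal
      (sqNorm H (sgdEnd γ θ₀ u.2 z - sgdEnd γ θ₀ u.1 z)) := fun u =>
    ((continuous_sqNorm H).measurable.comp
      ((measurable_sgdEnd γ θ₀ u.2).sub (measurable_sgdEnd γ θ₀ u.1))).ennreal_ofReal
  rw [lintegral_indepFun_countable (U := fun ω => (τ ω, τ' ω)) hU hZm hτZ hg,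
    (indepFun_iff_map_prod_eq_prod_map_map hτ.aemeasurable hτ'.aemeasurable).1 hττ']
  have : IsProbabilityMeasure (P.map τ) := Measure.isProbabilityMeasure_map hτ.aemeasurable
  have : IsProbabilityMeasure (P.map τ') := Measure.isProbabilityMeasure_map hτ'.aemeasurable
  rw [lintegral_prod _ (measurable_of_countable _).aemeasurable]
  set e : ℕ → ℝ≥0∞ := fun n =>
    ∑ l, excess γ H μ n (EuclideanSpace.basisFun (Fin d) ℝ l) with he
  have hae : ∀ᵐ b ∂(P.map τ), ∀ᵐ b' ∂(P.map τ'),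
      ∫⁻ ω, ENNReal.ofReal (sqNorm H (sgdEnd γ θ₀ b' (fun t => Z t ω) -
        sgdEnd γ θ₀ b (fun t => Z t ω))) ∂P ≤
      3 * (excess γ H μ b' (θ₀ - θ) + excess γ H μ b (θ₀ - θ) + ENNReal.ofReal a * e b) := by
    rw [hτlaw, hτlaw']
    filter_upwards [ae_uniformOn_mem (Finset.Ico s t)] with b hb
    filter_upwards [ae_uniformOn_mem (Finset.Ico t t')] with b' hb'
    rw [Finset.mem_Ico] at hb hb'
    -- The earlier run makes i steps alone and then shares its last b data with the later run.
    obtain ⟨i, rfl⟩ := Nat.exists_eq_add_of_le' (hb.2.le.trans hb'.1)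
    have := lintegral_sqNorm_sgdSteps_sub_le (θ₀ := θ₀) hμ hH ha haγ hZ hi hlaw 0 i b
    simpa only [sgdEnd, zero_sub] using this
  refine (lintegral_mono_ae (hae.mono fun b hb => lintegral_mono_ae hb)).trans ?_
  have hinner : ∀ b, ∫⁻ b', 3 * (excess γ H μ b' (θ₀ - θ) + excess γ H μ b (θ₀ - θ) +
      ENNReal.ofReal a * e b) ∂(P.map τ') =
      3 * (∫⁻ b', excess γ H μ b' (θ₀ - θ) ∂(P.map τ') + excess γ H μ b (θ₀ - θ) +
        ENNReal.ofReal a * e b) := by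
    intro b
    rw [lintegral_const_mul _ (measurable_of_countable _),
      lintegral_add_right _ measurable_const, lintegral_add_right _ measurable_const]
    simp
  simp only [hinner]
  rw [lintegral_const_mul _ (measurable_of_countable _),
    lintegral_add_right _ (measurable_of_countable _),
    lintegral_add_right _ (measurable_of_countable _), lintegral_const, measure_univ, mul_one,
    lintegral_const_mul _ (measurable_of_countable _), he,
    lintegral_finsetSum _ fun _ _ => measurable_of_countable _, hτlaw, hτlaw']
  have htt : t < t' := by omega
  have hn : (0 : ℝ) < t - s := sub_pos.2 (by exact_mod_cast hst)
  have hnn' : (t : ℝ) - s ≤ t' - t := by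
    rw [← Nat.cast_sub hst.le, ← Nat.cast_sub htt.le]
    exact_mod_cast htt'
  set B : ℝ := (1 - xi γ R H) ^ s / (γ * (2 - γ * R ^ 2)) / (t - s) with hB
  have hB0 : 0 ≤ B := by positivity
  -- The second range has a larger burn-in and is at least as long, so B serves for it too.
  have b1 : ∫⁻ n, excess γ H μ n (θ₀ - θ) ∂(uniformOn (Finset.Ico t t' : Set ℕ)) ≤
      ENNReal.ofReal (B * ‖θ₀ - θ‖ ^ 2) := by
    refine (hμ.lintegral_excess_uniformOn_le hd hH hκ htt _).trans (ENNReal.ofReal_le_ofReal ?_)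
    have hξ : 1 - xi γ R H ≤ 1 := by
      have : 0 ≤ lambdaMin H := by
        rw [lambdaMin_eq_sInf hH.1]
        exact Real.sInf_nonneg (by rintro _ ⟨i, rfl⟩; exact hH.eigenvalues_nonneg i)
      have : 0 ≤ xi γ R H := mul_nonneg hκ.le this
      linarith
    have h1 : (1 - xi γ R H) ^ t ≤ (1 - xi γ R H) ^ s := pow_le_pow_of_le_one hρ hξ hst.le
    calc (1 - xi γ R H) ^ t * ‖θ₀ - θ‖ ^ 2 / (γ * (2 - γ * R ^ 2)) / (t' - t)
        ≤ (1 - xi γ R H) ^ s * ‖θ₀ - θ‖ ^ 2 / (γ * (2 - γ * R ^ 2)) / (t - s) := by gcongr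
      _ = _ := by rw [hB]; ring
  have b2 : ∀ v, ∫⁻ n, excess γ H μ n v ∂(uniformOn (Finset.Ico s t : Set ℕ)) ≤
      ENNReal.ofReal (B * ‖v‖ ^ 2) := fun v => by
    refine (hμ.lintegral_excess_uniformOn_le hd hH hκ hst _).trans (le_of_eq ?_)
    congr 1
    rw [hB]; ring
  calc _ ≤ 3 * (ENNReal.ofReal (B * ‖θ₀ - θ‖ ^ 2) + ENNReal.ofReal (B * ‖θ₀ - θ‖ ^ 2) +
        ENNReal.ofReal a * ∑ l : Fin d,
          ENNReal.ofReal (B * ‖EuclideanSpace.basisFun (Fin d) ℝ l‖ ^ 2)) := by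
        gcongr
        · exact b2 _
        · exact b2 _
    _ = ENNReal.ofReal (3 * (B * ‖θ₀ - θ‖ ^ 2 + B * ‖θ₀ - θ‖ ^ 2 + a * (d * B))) := by
        have h0 : 0 ≤ B * ‖θ₀ - θ‖ ^ 2 := by positivity
        rw [ENNReal.ofReal_mul (p := 3) (by norm_num),
          ENNReal.ofReal_add (by positivity) (by positivity),
          ENNReal.ofReal_add h0 h0, ENNReal.ofReal_mul (p := a) ha, ENNReal.ofReal_mul (p := (d : ℝ))
          (by positivity)]
        simp
    _ ≤ _ := by
        apply ENNReal.ofReal_le_ofReal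
        have e1 : a * (d * B) = σ ^ 2 * d / (2 - γ * R ^ 2) ^ 2 *
            ((1 - xi γ R H) ^ s / (t - s)) := by
          rw [ha_def, hB]; field_simp
        have e2 : B * ‖θ₀ - θ‖ ^ 2 = ‖θ₀ - θ‖ ^ 2 / (γ * (2 - γ * R ^ 2)) *
            ((1 - xi γ R H) ^ s / (t - s)) := by
          rw [hB]; ring
        have e3 : 0 ≤ a * (d * B) := by positivity
        -- The bias counts twice and the noise once; the factor 6 doubles the noise to fit the
        -- constant c.
        have e4 : 6 * cConst γ σ R θ₀ θ * (1 - xi γ R H) ^ s / (t - s) =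
            6 * (a * (d * B) + B * ‖θ₀ - θ‖ ^ 2) := by
          rw [e1, e2, cConst]; ring
        rw [e4]
        linarith

end Coupling

/-! ### Numerical bounds for the sum over the levels -/

section Bounds

lemma sum_half_pow_le (n : ℕ) : ∑ j ∈ Finset.range n, (1 / 2 : ℝ) ^ (j + 1) ≤ 1 := by
  have : ∑ j ∈ Finset.range n, (1 / 2 : ℝ) ^ (j + 1) = 1 - (1 / 2) ^ n := by
    induction n with
    | zero => simp
    | succ n ih => rw [Finset.sum_range_succ, ih]; ring
  rw [this]
  have : (0 : ℝ) ≤ (1 / 2) ^ n := by positivity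
  linarith

lemma exp_neg_natCast_le (n : ℕ) : Real.exp (-(n : ℝ)) ≤ (1 / 2) ^ n := by
  have h : Real.exp (-1) ≤ 1 / 2 := by
    rw [Real.exp_neg, one_div]
    exact inv_anti₀ (by norm_num) (by linarith [Real.add_one_le_exp (1 : ℝ)])
  calc Real.exp (-(n : ℝ)) = Real.exp (-1) ^ n := by rw [← Real.exp_nat_mul]; ring_nf
    _ ≤ _ := pow_le_pow_left₀ (Real.exp_pos _).le h n

lemma natCast_add_one_rpow_le_exp (n : ℕ) {δ : ℝ} (hδ : 0 ≤ δ) :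
    ((n : ℝ) + 1) ^ δ ≤ Real.exp (δ * n) := by
  rw [mul_comm, Real.exp_mul]
  exact Real.rpow_le_rpow (by positivity) (Real.add_one_le_exp _) hδ

lemma pow_le_exp_neg {ρ ξ : ℝ} (hρ0 : 0 ≤ ρ) (hρ : ρ = 1 - ξ) (n : ℕ) :
    ρ ^ n ≤ Real.exp (-(ξ * n)) := by
  have : ρ ≤ Real.exp (-ξ) := by linarith [Real.add_one_le_exp (-ξ)]
  calc ρ ^ n ≤ Real.exp (-ξ) ^ n := pow_le_pow_left₀ hρ0 this n
    _ = _ := by rw [← Real.exp_nat_mul]; ring_nf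

lemma three_le_log {A : ℝ} (hA : 24 ≤ A) : 3 ≤ Real.log A := by
  rw [Real.le_log_iff_exp_le (by linarith)]
  have h1 := Real.exp_one_lt_d9
  have : Real.exp 3 = Real.exp 1 ^ 3 := by rw [← Real.exp_nat_mul]; norm_num
  rw [this]
  calc Real.exp 1 ^ 3 ≤ 2.72 ^ 3 := pow_le_pow_left₀ (Real.exp_pos 1).le (by linarith) 3
    _ ≤ A := by norm_num; linarith

lemma le_two_pow_of_two_mul_log_le {A : ℝ} (hA : 0 < A) {m : ℕ} (hlog : 0 ≤ Real.log A)
    (hm : 2 * Real.log A ≤ m) : A ≤ 2 ^ m := by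
  have h2 := Real.log_two_gt_d9
  rw [← Real.log_le_log_iff hA (by positivity), Real.log_pow]
  have := mul_nonneg hlog (sub_nonneg.2 h2.le)
  nlinarith

lemma mul_two_pow_sub_one_ge {k l : ℕ} (hk : 2 ≤ k) : 2 ^ (l + 1) ≤ k * (2 ^ (l + 1) - 1) := by
  have h1 : 2 ≤ 2 ^ (l + 1) := by rw [pow_succ]; have := Nat.one_le_two_pow (n := l); omega
  calc 2 ^ (l + 1) ≤ 2 * (2 ^ (l + 1) - 1) := by omega
    _ ≤ _ := Nat.mul_le_mul_right _ hk

/-- The polynomial factor is at most (4L)^δ e^{δj}, while the exponent is at least (8δ + 16)(j + 1)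
because 2^j ≥ j + 1. -/
lemma tail_term_le {δ ξ L : ℝ} (hδ : 1 < δ) {m : ℕ} (hL : 3 ≤ L) (hmL : m ≤ 2 * L + 1)
    (hξ : 8 * δ + 16 ≤ ξ * 2 ^ m) (j : ℕ) :
    ((m : ℝ) + j + 1) ^ δ * Real.exp (-(ξ * 2 ^ (m + j))) ≤
      (4 * L) ^ δ * (1 / 2) ^ (j + 1) := by
  have hj : (j : ℝ) + 1 ≤ 2 ^ j := by exact_mod_cast Nat.lt_two_pow_self (n := j)
  have h1 : ((m : ℝ) + j + 1) ^ δ ≤ (4 * L) ^ δ * Real.exp (δ * j) := by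
    calc ((m : ℝ) + j + 1) ^ δ ≤ ((4 * L) * (j + 1)) ^ δ := by
          refine Real.rpow_le_rpow (by positivity) ?_ (by linarith)
          have : (0 : ℝ) ≤ j := by positivity
          nlinarith
      _ = (4 * L) ^ δ * ((j : ℝ) + 1) ^ δ := Real.mul_rpow (by linarith) (by positivity)
      _ ≤ _ := by
          gcongr
          exact natCast_add_one_rpow_le_exp j (by linarith)
  have h2 : (8 * δ + 16) * ((j : ℝ) + 1) ≤ ξ * 2 ^ (m + j) := by
    rw [pow_add, ← mul_assoc]
    exact mul_le_mul hξ hj (by positivity) (by linarith)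
  calc ((m : ℝ) + j + 1) ^ δ * Real.exp (-(ξ * 2 ^ (m + j)))
      ≤ (4 * L) ^ δ * Real.exp (δ * j) * Real.exp (-(ξ * 2 ^ (m + j))) := by gcongr
    _ = (4 * L) ^ δ * Real.exp (δ * j + -(ξ * 2 ^ (m + j))) := by rw [mul_assoc, Real.exp_add]
    _ ≤ (4 * L) ^ δ * Real.exp (-((j + 1 : ℕ) : ℝ)) := by
        gcongr
        push_cast
        have : (0 : ℝ) ≤ j := by positivity
        nlinarith
    _ ≤ _ := by
        gcongr
        exact exp_neg_natCast_le _

/-- The sum is cut near l = 2 log A, where ξ2^l has outgrown δ. Below the cut ρ is bounded by 1;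
above it the terms are dominated by a geometric series. -/
lemma sum_level_le {δ ξ α ρ : ℝ} (hδ : 1 < δ) (hξ : 0 < ξ) (hρ : ρ = 1 - ξ) (hρ0 : 0 ≤ ρ)
    (hα : 0 < α) (hα' : α ≤ 1 / 2) {k : ℕ} (hk : 2 ≤ k) (n : ℕ) :
    36 + 12 * ∑ l ∈ Finset.range n, ((l : ℝ) + 2) ^ δ * ρ ^ (k * (2 ^ (l + 1) - 1)) ≤
      22 + 6 * (4 * Real.log ((4 * δ + 8) / (α * ξ))) ^ (δ + 1) := by
  set A := (4 * δ + 8) / (α * ξ) with hA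
  have hξ1 : ξ ≤ 1 := by linarith
  have hAξ : 8 * δ + 16 ≤ ξ * A := by
    have : ξ * A = (4 * δ + 8) / α := by rw [hA]; field_simp
    rw [this, le_div_iff₀ hα]
    nlinarith
  have hA0 : 0 < A := by positivity
  have hA24 : 24 ≤ A := by nlinarith
  set L := Real.log A with hLdef
  have hL : 3 ≤ L := three_le_log hA24
  -- The exponent at l contains 2^(l+1), so a tail starting at l = m needs the lower bound at
  -- 2^(m+1).
  obtain ⟨m, hm⟩ : ∃ m, m + 1 = ⌈2 * L⌉₊ :=
    ⟨⌈2 * L⌉₊ - 1, Nat.sub_add_cancel (Nat.one_le_ceil_iff.2 (by linarith))⟩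
  have hm1 : 2 * L ≤ (m + 1 : ℕ) := hm ▸ Nat.le_ceil _
  have hm2 : ((m + 1 : ℕ) : ℝ) ≤ 2 * L + 1 := hm ▸ (Nat.ceil_lt_add_one (by linarith)).le
  have hξm : 8 * δ + 16 ≤ ξ * 2 ^ (m + 1) :=
    hAξ.trans (mul_le_mul_of_nonneg_left
      (le_two_pow_of_two_mul_log_le hA0 (by linarith) hm1) hξ.le)
  have hterm : ∀ l : ℕ, ρ ^ (k * (2 ^ (l + 1) - 1)) ≤ Real.exp (-(ξ * 2 ^ (l + 1))) := fun l => by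
    refine (pow_le_exp_neg hρ0 hρ _).trans (Real.exp_le_exp.2 (neg_le_neg ?_))
    gcongr
    exact_mod_cast mul_two_pow_sub_one_ge hk
  have hW : (4 * L) ^ (1 : ℝ) ≤ (4 * L) ^ δ :=
    Real.rpow_le_rpow_of_exponent_le (by linarith) hδ.le
  rw [Real.rpow_one] at hW
  have hsum : ∑ l ∈ Finset.range n, ((l : ℝ) + 2) ^ δ * ρ ^ (k * (2 ^ (l + 1) - 1)) ≤
      2 * L * (3 / 4 * (4 * L) ^ δ) + (4 * L) ^ δ := by
    calc _ ≤ ∑ l ∈ Finset.range (m + n), ((l : ℝ) + 2) ^ δ * ρ ^ (k * (2 ^ (l + 1) - 1)) := by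
          refine Finset.sum_le_sum_of_subset_of_nonneg
            (Finset.range_subset_range.2 (Nat.le_add_left n m)) fun l _ _ => by positivity
      _ ≤ ∑ l ∈ Finset.range m, 3 / 4 * (4 * L) ^ δ +
          ∑ j ∈ Finset.range n, (4 * L) ^ δ * (1 / 2) ^ (j + 1) := by
          rw [Finset.sum_range_add]
          refine add_le_add (Finset.sum_le_sum fun l hl => ?_) (Finset.sum_le_sum fun j _ => ?_)
          · have hl' : ((l + 1 : ℕ) : ℝ) ≤ m := by exact_mod_cast Finset.mem_range.1 hl
            push_cast at hl' hm2
            calc ((l : ℝ) + 2) ^ δ * ρ ^ (k * (2 ^ (l + 1) - 1)) ≤ ((l : ℝ) + 2) ^ δ * 1 := by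
                  gcongr
                  exact pow_le_one₀ hρ0 (by linarith)
              _ ≤ (3 / 4 * (4 * L)) ^ δ := by
                  rw [mul_one]
                  exact Real.rpow_le_rpow (by positivity) (by linarith) (by linarith)
              _ = (3 / 4) ^ δ * (4 * L) ^ δ := Real.mul_rpow (by norm_num) (by linarith)
              _ ≤ _ := by
                  gcongr
                  calc (3 / 4 : ℝ) ^ δ ≤ (3 / 4) ^ (1 : ℝ) :=
                        Real.rpow_le_rpow_of_exponent_ge (by norm_num) (by norm_num) hδ.le
                    _ = _ := Real.rpow_one _
          · have := tail_term_le hδ hL hm2 hξm j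
            refine le_trans (mul_le_mul_of_nonneg_left (hterm _) (by positivity)) ?_
            refine le_trans (le_of_eq ?_) this
            push_cast
            rw [show m + 1 + j = m + j + 1 by ring]
            congr 2
            ring
      _ ≤ _ := by
          rw [Finset.sum_const, Finset.card_range, nsmul_eq_mul, ← Finset.mul_sum]
          push_cast at hm2
          refine add_le_add (mul_le_mul_of_nonneg_right (by linarith) (by positivity)) ?_
          exact mul_le_of_le_one_right (by positivity) (sum_half_pow_le n)
  rw [Real.rpow_add (by linarith), Real.rpow_one]
  -- With W = (4L)^δ this is 36 + 18LW + 12W ≤ 22 + 24LW, which follows from L ≥ 3 and W ≥ 4L.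
  nlinarith

/-- With z = αξk, the first level and the sum over all later ones both contribute multiples of
e^{-z}, 48e^{-z} in total. Half of the exponent absorbs 2k^{δ+1}. -/
lemma sum_level_le_of_le {δ ξ α ρ : ℝ} (hδ : 1 < δ) (hξ : 0 < ξ) (hρ : ρ = 1 - ξ) (hρ0 : 0 ≤ ρ)
    (hα : 0 < α) (hα' : α ≤ 1 / 2) {k : ℕ} (hk : 2 ≤ k)
    (hkA : (4 * δ + 8) / (α * ξ) * Real.log ((4 * δ + 8) / (α * ξ)) ≤ k) (n : ℕ) :
    36 * ρ ^ burnIn α k +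
      12 * ∑ l ∈ Finset.range n, ((l : ℝ) + 2) ^ δ * ρ ^ (k * (2 ^ (l + 1) - 1)) ≤
      24 / (k : ℝ) ^ (δ + 1) * Real.exp (-(α * ξ * k / 2)) := by
  set A := (4 * δ + 8) / (α * ξ) with hA
  have hξ1 : ξ ≤ 1 := by linarith
  have hk0 : (0 : ℝ) < k := by positivity
  have hk2 : (2 : ℝ) ≤ k := by exact_mod_cast hk
  have hA0 : 0 < A := by positivity
  have hA24 : 24 ≤ A := by
    rw [hA, le_div_iff₀ (by positivity)]
    nlinarith
  have hL := three_le_log hA24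
  set z := α * ξ * k with hz
  have hzA : z = (4 * δ + 8) * (k / A) := by rw [hz, hA]; field_simp
  have hkL : Real.log A ≤ k / A := by rw [le_div_iff₀ hA0]; linarith
  have hzδ : δ + 1 ≤ z := by rw [hzA]; nlinarith
  have hlogk : Real.log k ≤ 2 * (k / A) := by
    have h1 : Real.log k = Real.log (k / A) + Real.log A := by
      rw [Real.log_div hk0.ne' hA0.ne']; ring
    have h2 := Real.log_le_self (div_nonneg hk0.le hA0.le)
    linarith
  -- The constant 4δ + 8 is chosen so that (δ + 2) log k ≤ (δ + 2) · 2k/A = z/2.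
  have hpow : 2 * (k : ℝ) ^ (δ + 1) ≤ Real.exp (z / 2) := by
    calc 2 * (k : ℝ) ^ (δ + 1) ≤ k * (k : ℝ) ^ (δ + 1) := by gcongr
      _ = (k : ℝ) ^ (δ + 2) := by
          rw [show δ + 2 = 1 + (δ + 1) by ring, Real.rpow_add hk0 1, Real.rpow_one]
      _ = Real.exp (Real.log k * (δ + 2)) := Real.rpow_def_of_pos hk0 _
      _ ≤ _ := by
          apply Real.exp_le_exp.2
          rw [hzA]
          nlinarith
  have hb : ρ ^ burnIn α k ≤ Real.exp (-z) := by
    refine (pow_le_exp_neg hρ0 hρ _).trans (Real.exp_le_exp.2 (neg_le_neg ?_))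
    have : α * k ≤ burnIn α k := Nat.le_ceil _
    rw [hz]
    nlinarith
  have hsum : ∑ l ∈ Finset.range n, ((l : ℝ) + 2) ^ δ * ρ ^ (k * (2 ^ (l + 1) - 1)) ≤
      Real.exp (-z) := by
    calc _ ≤ ∑ l ∈ Finset.range n, Real.exp (-z) * (1 / 2) ^ (l + 1) := by
          refine Finset.sum_le_sum fun l _ => ?_
          have h1 : ((l : ℝ) + 2) ^ δ ≤ Real.exp (δ * (l + 1 : ℕ)) := by
            have := natCast_add_one_rpow_le_exp (l + 1) (δ := δ) (by linarith)
            push_cast at this ⊢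
            rwa [add_assoc, one_add_one_eq_two] at this
          have h2 : ((k * (l + 1) : ℕ) : ℝ) ≤ (k * (2 ^ (l + 1) - 1) : ℕ) := by
            have : l + 1 < 2 ^ (l + 1) := Nat.lt_two_pow_self
            exact_mod_cast Nat.mul_le_mul_left k (by omega)
          have h3 : ρ ^ (k * (2 ^ (l + 1) - 1)) ≤ Real.exp (-(2 * z * (l + 1 : ℕ))) := by
            refine (pow_le_exp_neg hρ0 hρ _).trans (Real.exp_le_exp.2 (neg_le_neg ?_))
            refine le_trans ?_ (mul_le_mul_of_nonneg_left h2 hξ.le)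
            push_cast
            have h4 : 2 * z ≤ ξ * k := by
              rw [hz]
              have : 0 < ξ * k := by positivity
              nlinarith
            calc 2 * z * ((l : ℝ) + 1) ≤ ξ * k * (l + 1) := by gcongr
              _ = _ := by ring
          calc ((l : ℝ) + 2) ^ δ * ρ ^ (k * (2 ^ (l + 1) - 1))
              ≤ Real.exp (δ * (l + 1 : ℕ)) * Real.exp (-(2 * z * (l + 1 : ℕ))) := by gcongr
            _ ≤ Real.exp (-z) * Real.exp (-((l + 1 : ℕ) : ℝ)) := by
                rw [← Real.exp_add, ← Real.exp_add]
                apply Real.exp_le_exp.2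
                push_cast
                have : (0 : ℝ) ≤ l := by positivity
                -- Since z ≥ δ + 1, the excess (2l + 1)z of 2z(l + 1) over z is at least (δ + 1)(l +
                -- 1).
                nlinarith
            _ ≤ _ := by
                gcongr
                exact exp_neg_natCast_le _
      _ ≤ _ := by
          rw [← Finset.mul_sum]
          exact mul_le_of_le_one_right (Real.exp_pos _).le (sum_half_pow_le n)
  have hfin : 48 * Real.exp (-z) ≤ 24 / (k : ℝ) ^ (δ + 1) * Real.exp (-(z / 2)) := by
    have e : Real.exp (-z) = Real.exp (-(z / 2)) * Real.exp (-(z / 2)) := by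
      rw [← Real.exp_add]; ring_nf
    rw [e, ← mul_assoc]
    gcongr
    rw [le_div_iff₀ (by positivity), Real.exp_neg]
    have he := Real.exp_pos (z / 2)
    calc 48 * (Real.exp (z / 2))⁻¹ * (k : ℝ) ^ (δ + 1)
        = 24 * (2 * (k : ℝ) ^ (δ + 1)) * (Real.exp (z / 2))⁻¹ := by ring
      _ ≤ 24 * Real.exp (z / 2) * (Real.exp (z / 2))⁻¹ := by gcongr
      _ = 24 := by field_simp
  linarith

end Bounds

/-! ### The ranges and probabilities of the levels -/

section Levels

/-- The left end point of the range of the random start at level `l`. -/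
noncomputable def levelStart (α : ℝ) (k l : ℕ) : ℕ :=
  if l = 0 then burnIn α k else k * (2 ^ l - 1)

/-- The ranges are consecutive: level 1 begins at k(2 - 1) = k, where level 0 ends. -/
lemma startRange_eq (α : ℝ) (k l : ℕ) : startRange α k l =
    (Finset.Ico (levelStart α k l) (levelStart α k (l + 1)) : Set ℕ) := by
  by_cases hl : l = 0 <;> simp [startRange, levelStart, hl]

lemma burnIn_le {α : ℝ} (hα' : α ≤ 1 / 2) (k : ℕ) : burnIn α k ≤ (k + 1) / 2 := by
  refine Nat.ceil_le.2 ?_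
  have h1 : (k : ℝ) ≤ 2 * ((k + 1) / 2 : ℕ) := by
    have : k ≤ 2 * ((k + 1) / 2) := by omega
    exact_mod_cast this
  have : (0 : ℝ) ≤ k := by positivity
  nlinarith

lemma levelStart_succ_sub {α : ℝ} {k l : ℕ} (hl : l ≠ 0) :
    levelStart α k (l + 1) = levelStart α k l + k * 2 ^ l := by
  simp only [levelStart, hl, if_false, Nat.succ_ne_zero]
  rw [← mul_add]
  congr 1
  have := Nat.one_le_two_pow (n := l)
  rw [pow_succ]
  omega

lemma levelStart_lt {α : ℝ} (hα' : α ≤ 1 / 2) {k : ℕ} (hk : 2 ≤ k) (l : ℕ) :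
    levelStart α k l < levelStart α k (l + 1) := by
  by_cases hl : l = 0
  · have := burnIn_le hα' k
    simp [levelStart, hl]
    omega
  · rw [levelStart_succ_sub hl]
    have : 0 < k * 2 ^ l := by positivity
    omega

lemma levelSize_le {α : ℝ} (k l : ℕ) :
    levelStart α k (l + 1) - levelStart α k l ≤
      levelStart α k (l + 2) - levelStart α k (l + 1) := by
  rw [levelStart_succ_sub (l := l + 1) (by omega), Nat.add_sub_cancel_left]
  by_cases hl : l = 0
  · simp [levelStart, hl]
    omega
  · rw [levelStart_succ_sub hl, Nat.add_sub_cancel_left]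
    gcongr <;> omega

lemma le_levelStart {α : ℝ} {k : ℕ} (hk : 2 ≤ k) (l : ℕ) : l ≤ levelStart α k l := by
  by_cases hl : l = 0
  · simp [hl]
  · simp only [levelStart, hl, if_false]
    have : l < 2 ^ l := Nat.lt_two_pow_self
    calc l ≤ 1 * (2 ^ l - 1) := by omega
      _ ≤ _ := Nat.mul_le_mul_right _ (by omega)

/-- The subtracted term is at most half of the first one. -/
lemma le_levelProb {δ : ℝ} (hδ : 0 ≤ δ) (l : ℕ) :
    1 / ((2 : ℝ) ^ (l + 1) * ((l : ℝ) + 1) ^ δ) ≤ levelProb δ l := by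
  have h1 : 1 / ((2 : ℝ) ^ (l + 1) * ((l : ℝ) + 2) ^ δ) ≤
      1 / ((2 : ℝ) ^ (l + 1) * ((l : ℝ) + 1) ^ δ) := by
    gcongr
    linarith
  have h2 : 1 / ((2 : ℝ) ^ l * ((l : ℝ) + 1) ^ δ) =
      2 * (1 / ((2 : ℝ) ^ (l + 1) * ((l : ℝ) + 1) ^ δ)) := by
    rw [pow_succ]; field_simp
  rw [levelProb, h2]
  linarith

lemma levelProb_pos {δ : ℝ} (hδ : 0 ≤ δ) (l : ℕ) : 0 < levelProb δ l :=
  lt_of_lt_of_le (by positivity) (le_levelProb hδ l)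

lemma inv_levelProb_le {δ : ℝ} (hδ : 0 ≤ δ) (l : ℕ) :
    (levelProb δ l)⁻¹ ≤ 2 ^ (l + 1) * ((l : ℝ) + 1) ^ δ := by
  have := inv_anti₀ (by positivity) (le_levelProb hδ l)
  simpa using this

/-- The bound on `k` times the contribution of the first levels to the second moment. -/
lemma mul_sum_levels_le {δ α ρ C : ℝ} (hδ : 0 ≤ δ) (hρ0 : 0 ≤ ρ) (hα' : α ≤ 1 / 2) {k : ℕ}
    (hk : 2 ≤ k) (hC : 0 ≤ C) (n : ℕ) :
    k * ∑ l ∈ Finset.range (n + 1), (levelProb δ l)⁻¹ *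
      (6 * C * ρ ^ levelStart α k l / (levelStart α k (l + 1) - levelStart α k l)) ≤
    C * (36 * ρ ^ burnIn α k +
      12 * ∑ l ∈ Finset.range n, ((l : ℝ) + 2) ^ δ * ρ ^ (k * (2 ^ (l + 1) - 1))) := by
  have hk0 : (0 : ℝ) < k := by positivity
  rw [Finset.sum_range_succ', mul_add, Finset.mul_sum, mul_add, add_comm]
  refine add_le_add ?_ ?_
  · have hs : (k : ℝ) ≤ 3 * (k - burnIn α k) := by
      have h1 := burnIn_le hα' k
      have h2 : k + 3 * burnIn α k ≤ 3 * k := by omega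
      have : (k : ℝ) + 3 * burnIn α k ≤ 3 * k := by exact_mod_cast h2
      linarith
    have hpos : (0 : ℝ) < k - burnIn α k := by linarith
    have hp : (levelProb δ 0)⁻¹ ≤ 2 := by simpa using inv_levelProb_le hδ 0
    have e0 : levelStart α k 0 = burnIn α k := by simp [levelStart]
    have e1 : levelStart α k (0 + 1) = k := by simp [levelStart]
    rw [e0, e1]
    calc k * ((levelProb δ 0)⁻¹ * (6 * C * ρ ^ burnIn α k / (k - burnIn α k)))
        ≤ (3 * (k - burnIn α k)) * (2 * (6 * C * ρ ^ burnIn α k / (k - burnIn α k))) := by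
          have := (levelProb_pos hδ 0).le
          gcongr
      _ = _ := by field_simp; ring
  · rw [← mul_assoc, Finset.mul_sum]
    refine Finset.sum_le_sum fun l _ => ?_
    have hp := inv_levelProb_le hδ (l + 1)
    rw [levelStart_succ_sub (l := l + 1) (by omega)]
    have e : levelStart α k (l + 1) = k * (2 ^ (l + 1) - 1) := by simp [levelStart]
    rw [← e]
    push_cast at hp ⊢
    rw [add_sub_cancel_left]
    have e2 : ((l : ℝ) + 1 + 1) = l + 2 := by ring
    rw [e2] at hp
    -- The inverse probability exceeds the range length by one power of 2, whence 12 = 2 · 6.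
    calc k * ((levelProb δ (l + 1))⁻¹ * (6 * C * ρ ^ levelStart α k (l + 1) / (k * 2 ^ (l + 1))))
        ≤ k * ((2 ^ (l + 1 + 1) * ((l : ℝ) + 2) ^ δ) *
          (6 * C * ρ ^ levelStart α k (l + 1) / (k * 2 ^ (l + 1)))) := by gcongr
      _ = _ := by field_simp; ring

end Levels

/-! ### Integrability and mean of a run with a random start -/

section RandomStart

variable {d : ℕ} {Ω : Type*} [MeasurableSpace Ω] {P : Measure Ω} [IsProbabilityMeasure P]
  {μ : Measure (EuclideanSpace ℝ (Fin d) × ℝ)}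
  {H : Matrix (Fin d) (Fin d) ℝ} {θ θ₀ : EuclideanSpace ℝ (Fin d)} {σ R γ : ℝ}
  {Z : ℤ → Ω → EuclideanSpace ℝ (Fin d) × ℝ}

lemma measurable_sgdEnd_eval {A : Type*} [MeasurableSpace A] {n : A → ℕ}
    {z : A → ℤ → EuclideanSpace ℝ (Fin d) × ℝ} (hn : Measurable n) (hz : Measurable z) :
    Measurable fun a => sgdEnd γ θ₀ (n a) (z a) := by
  have : Measurable (Function.uncurry (sgdEnd γ θ₀)) :=
    measurable_from_prod_countable_right fun n => measurable_sgdEnd γ θ₀ n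
  exact this.comp (hn.prodMk hz)

lemma memLp_sgdEnd_uniformOn (hμ : IsLeastSquaresLaw μ H θ σ R) (hd : 0 < d)
    (hH : H.PosSemidef) {a : ℝ} (ha : 0 ≤ a)
    (haγ : γ ^ 2 * σ ^ 2 ≤ a * (γ * (2 - γ * R ^ 2))) (hγ : 0 ≤ γ * (2 - γ * R ^ 2))
    (hZ : ∀ t, Measurable (Z t)) (hi : iIndepFun Z P) (hlaw : ∀ t, P.map (Z t) = μ)
    {τ : Ω → ℕ} (hτ : Measurable τ) {s : Finset ℕ}
    (hτlaw : P.map τ = uniformOn (s : Set ℕ)) :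
    MemLp (fun ω => sgdEnd γ θ₀ (τ ω) (fun t => Z t ω)) 2 P := by
  have hL : MemLp (fun ω => ∑ b ∈ s, ‖sgdEnd γ θ₀ b (fun t => Z t ω)‖) 2 P :=
    memLp_finsetSum _ fun b _ => (memLp_sgdSteps hμ hd hH ha haγ hγ hZ hi hlaw _ _).norm
  refine hL.mono (measurable_sgdEnd_eval hτ (measurable_pi_lambda _ hZ)).aestronglyMeasurable ?_
  have hmem : ∀ᵐ ω ∂P, τ ω ∈ s := by
    have := ae_uniformOn_mem s
    rw [← hτlaw] at this
    exact ae_of_ae_map hτ.aemeasurable this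
  filter_upwards [hmem] with ω hω
  rw [Real.norm_of_nonneg (Finset.sum_nonneg fun _ _ => norm_nonneg _)]
  exact Finset.single_le_sum (f := fun b => ‖sgdEnd γ θ₀ b (fun t => Z t ω)‖)
    (fun _ _ => norm_nonneg _) hω

lemma integral_sgdEnd_uniformOn (hμ : IsLeastSquaresLaw μ H θ σ R) (hd : 0 < d)
    (hH : H.PosSemidef) {a : ℝ} (ha : 0 ≤ a)
    (haγ : γ ^ 2 * σ ^ 2 ≤ a * (γ * (2 - γ * R ^ 2))) (hγ : 0 ≤ γ * (2 - γ * R ^ 2))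
    (hZ : ∀ t, Measurable (Z t)) (hi : iIndepFun Z P) (hlaw : ∀ t, P.map (Z t) = μ)
    {τ : Ω → ℕ} (hτ : Measurable τ) {s : Finset ℕ}
    (hτlaw : P.map τ = uniformOn (s : Set ℕ)) (hτZ : IndepFun τ (fun ω t => Z t ω) P) :
    ∫ ω, sgdEnd γ θ₀ (τ ω) (fun t => Z t ω) ∂P =
      (s.card : ℝ)⁻¹ • ∑ b ∈ s, ((meanStep γ μ)^[b] (θ₀ - θ) + θ) := by
  rw [integral_indepFun_countable hτ (measurable_pi_lambda _ hZ) hτZ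
    (fun n => measurable_sgdEnd γ θ₀ n)
    ((memLp_sgdEnd_uniformOn hμ hd hH ha haγ hγ hZ hi hlaw hτ hτlaw).integrable one_le_two),
    hτlaw, integral_uniformOn]
  congr 1
  exact Finset.sum_congr rfl fun b _ => integral_sgdSteps hμ hd hH ha haγ hγ hZ hi hlaw _ _

end RandomStart

/-- Used for the means of the levels, whose ranges move off to infinity. -/
lemma tendsto_average {E : Type*} [NormedAddCommGroup E] [NormedSpace ℝ E] {u : ℕ → E} {L : E}
    (hu : Filter.Tendsto u Filter.atTop (nhds L)) {s : ℕ → Finset ℕ}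
    (hs : ∀ l, (s l).Nonempty) (hsl : ∀ l, ∀ b ∈ s l, l ≤ b) :
    Filter.Tendsto (fun l => ((s l).card : ℝ)⁻¹ • ∑ b ∈ s l, u b) Filter.atTop (nhds L) := by
  rw [Metric.tendsto_atTop] at hu ⊢
  intro ε hε
  obtain ⟨B, hB⟩ := hu (ε / 2) (half_pos hε)
  refine ⟨B, fun l hl => ?_⟩
  have hc : (0 : ℝ) < (s l).card := by exact_mod_cast (hs l).card_pos
  have e : ((s l).card : ℝ)⁻¹ • ∑ b ∈ s l, u b - L =
      ((s l).card : ℝ)⁻¹ • ∑ b ∈ s l, (u b - L) := by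
    rw [Finset.sum_sub_distrib, smul_sub, Finset.sum_const, ← Nat.cast_smul_eq_nsmul ℝ, smul_smul,
      inv_mul_cancel₀ hc.ne', one_smul]
  rw [dist_eq_norm, e, norm_smul, norm_inv, Real.norm_of_nonneg hc.le]
  calc ((s l).card : ℝ)⁻¹ * ‖∑ b ∈ s l, (u b - L)‖
      ≤ ((s l).card : ℝ)⁻¹ * ∑ b ∈ s l, ε / 2 := by
        gcongr
        refine norm_sum_le_of_le _ fun b hb => ?_
        rw [← dist_eq_norm]
        exact (hB b (hl.trans (hsl l b hb))).le
    _ = ε / 2 := by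
        rw [Finset.sum_const, nsmul_eq_mul, ← mul_assoc, inv_mul_cancel₀ hc.ne', one_mul]
    _ < ε := half_lt_self hε

lemma levelEstimator_eq {d : ℕ} {Ω : Type*} (γ : ℝ) (θ₀ : EuclideanSpace ℝ (Fin d))
    (X : ℤ → Ω → EuclideanSpace ℝ (Fin d)) (Y : ℤ → Ω → ℝ) (τ : ℕ → Ω → ℕ) (l : ℕ) (ω : Ω) :
    levelEstimator γ θ₀ X Y τ l ω = sgdEnd γ θ₀ (τ l ω) (fun t => (X t ω, Y t ω)) := by
  simp [levelEstimator, sgd, sgdEnd]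

/-! ### The second moment of the single term estimator -/

section SingleTerm

variable {d : ℕ} {Ω : Type*} [MeasurableSpace Ω] {P : Measure Ω} [IsProbabilityMeasure P]
  {μ : Measure (EuclideanSpace ℝ (Fin d) × ℝ)}
  {H : Matrix (Fin d) (Fin d) ℝ} {θ θ₀ : EuclideanSpace ℝ (Fin d)} {σ R γ α δ : ℝ} {k : ℕ}
  {X : ℤ → Ω → EuclideanSpace ℝ (Fin d)} {Y : ℤ → Ω → ℝ} {τ : ℕ → Ω → ℕ} {N : Ω → ℕ}

/-- The estimator at level `n` as a function of the starts and of the data. -/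
noncomputable def levelTerm (γ δ : ℝ) (θ₀ : EuclideanSpace ℝ (Fin d)) (n : ℕ)
    (v : (ℕ → ℕ) × (ℤ → EuclideanSpace ℝ (Fin d) × ℝ)) : EuclideanSpace ℝ (Fin d) :=
  (levelProb δ n)⁻¹ • (sgdEnd γ θ₀ (v.1 (n + 1)) v.2 - sgdEnd γ θ₀ (v.1 n) v.2)

lemma measurable_levelTerm (γ δ : ℝ) (θ₀ : EuclideanSpace ℝ (Fin d)) (n : ℕ) :
    Measurable (levelTerm γ δ θ₀ n) := by
  have h : ∀ m : ℕ, Measurable fun v : (ℕ → ℕ) × (ℤ → EuclideanSpace ℝ (Fin d) × ℝ) =>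
      sgdEnd γ θ₀ (v.1 m) v.2 := fun m =>
    measurable_sgdEnd_eval ((measurable_pi_apply m).comp measurable_fst) measurable_snd
  exact ((h (n + 1)).sub (h n)).const_smul (levelProb δ n)⁻¹

lemma Z_eq_levelTerm {Ω : Type*} (γ δ : ℝ) (θ₀ : EuclideanSpace ℝ (Fin d))
    (X : ℤ → Ω → EuclideanSpace ℝ (Fin d)) (Y : ℤ → Ω → ℝ) (τ : ℕ → Ω → ℕ) (N : Ω → ℕ) (ω : Ω) :
    Z γ δ θ₀ X Y τ N ω = levelTerm γ δ θ₀ (N ω) (fun l => τ l ω, fun t => (X t ω, Y t ω)) := by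
  simp only [Z, levelTerm, levelEstimator_eq]

lemma measurable_starts_data (hX : ∀ t, Measurable (X t)) (hY : ∀ t, Measurable (Y t))
    (hτ : ∀ l, Measurable (τ l)) :
    Measurable fun ω => (fun l => τ l ω, fun t => (X t ω, Y t ω)) :=
  (measurable_pi_lambda _ hτ).prodMk (measurable_pi_lambda _ fun t => (hX t).prodMk (hY t))

lemma measurable_Z (hX : ∀ t, Measurable (X t)) (hY : ∀ t, Measurable (Y t))
    (hτ : ∀ l, Measurable (τ l)) (hN : Measurable N) : Measurable (Z γ δ θ₀ X Y τ N) := by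
  have h1 : Measurable fun p : ℕ × (ℕ → ℕ) × (ℤ → EuclideanSpace ℝ (Fin d) × ℝ) =>
      levelTerm γ δ θ₀ p.1 p.2 :=
    measurable_from_prod_countable_right fun n => measurable_levelTerm γ δ θ₀ n
  have h2 := h1.comp (hN.prodMk (measurable_starts_data hX hY hτ))
  exact (funext (Z_eq_levelTerm γ δ θ₀ X Y τ N)) ▸ h2

/-- The second moment of the single term estimator is at most a sum over the levels. -/
lemma lintegral_sqNorm_Z_le (hμ : IsLeastSquaresLaw μ H θ σ R) (hd : 0 < d)
    (hH : H.PosSemidef) (hγ0 : 0 < γ) (hγ : 0 < 2 - γ * R ^ 2) (hα' : α ≤ 1 / 2)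
    (hδ : 0 ≤ δ) (hk : 2 ≤ k) (hX : ∀ t, Measurable (X t)) (hY : ∀ t, Measurable (Y t))
    (hi : iIndepFun (fun t ω => (X t ω, Y t ω)) P)
    (hlaw : ∀ t, P.map (fun ω => (X t ω, Y t ω)) = μ)
    (hτ : ∀ l, Measurable (τ l)) (hτlaw : ∀ l, P.map (τ l) = uniformOn (startRange α k l))
    (hτi : iIndepFun τ P) (hτXY : IndepFun (fun ω l => τ l ω) (fun ω t => (X t ω, Y t ω)) P)
    (hN : Measurable N) (hNlaw : ∀ l, P.real {ω | N ω = l} = levelProb δ l)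
    (hNi : IndepFun N (fun ω => (fun l => τ l ω, fun t => (X t ω, Y t ω))) P) :
    ∫⁻ ω, ENNReal.ofReal (sqNorm H (Z γ δ θ₀ X Y τ N ω)) ∂P ≤
      ∑' l, ENNReal.ofReal ((levelProb δ l)⁻¹ *
        (6 * cConst γ σ R θ₀ θ * (1 - xi γ R H) ^ levelStart α k l /
          (levelStart α k (l + 1) - levelStart α k l))) := by
  have hV := measurable_starts_data hX hY hτ
  simp only [Z_eq_levelTerm]
  rw [lintegral_indepFun_countable hN hV hNi
    (g := fun n v => ENNReal.ofReal (sqNorm H (levelTerm γ δ θ₀ n v)))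
    (fun n => ((continuous_sqNorm H).measurable.comp
      (measurable_levelTerm γ δ θ₀ n)).ennreal_ofReal), lintegral_countable']
  refine ENNReal.tsum_le_tsum fun l => ?_
  have hp := levelProb_pos hδ l
  have hPN : P.map N {l} = ENNReal.ofReal (levelProb δ l) := by
    rw [Measure.map_apply hN (measurableSet_singleton l), ← hNlaw l]
    exact (ofReal_measureReal (measure_ne_top P _)).symm
  have hmem : ∀ l, P.map (τ l) =
      uniformOn (Finset.Ico (levelStart α k l) (levelStart α k (l + 1)) : Set ℕ) := fun l => by
    rw [hτlaw, startRange_eq]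
  have hind : IndepFun (fun ω => (τ l ω, τ (l + 1) ω)) (fun ω t => (X t ω, Y t ω)) P :=
    hτXY.comp (φ := fun f : ℕ → ℕ => (f l, f (l + 1))) (by fun_prop) measurable_id
  have hD := lintegral_sqNorm_sgdEnd_sub_le (θ₀ := θ₀) hμ hd hH hγ0 hγ
    (fun t => (hX t).prodMk (hY t)) hi hlaw (levelStart_lt hα' hk l) (levelSize_le k l) (hτ l)
    (hτ (l + 1)) (hmem l) (hmem (l + 1)) (hτi.indepFun (by omega)) hind
  simp only [levelTerm, sqNorm_smul, ENNReal.ofReal_mul (sq_nonneg (levelProb δ l)⁻¹), hPN]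
  rw [lintegral_const_mul' _ _ ENNReal.ofReal_ne_top]
  refine (mul_le_mul_left (mul_le_mul_right hD _) _).trans (le_of_eq ?_)
  -- The weight p_l⁻² of the square times the probability p_l leaves p_l⁻¹.
  rw [mul_right_comm, ← ENNReal.ofReal_mul (sq_nonneg _), ← ENNReal.ofReal_mul (by positivity)]
  congr 2
  field_simp

end SingleTerm

/-! ### The mean of the single term estimator and of the time average -/

section SingleTermExpectation

variable {d : ℕ} {Ω : Type*} [MeasurableSpace Ω] {P : Measure Ω} [IsProbabilityMeasure P]
  {μ : Measure (EuclideanSpace ℝ (Fin d) × ℝ)}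
  {H : Matrix (Fin d) (Fin d) ℝ} {θ θ₀ : EuclideanSpace ℝ (Fin d)} {σ R γ α δ : ℝ} {k : ℕ}
  {X : ℤ → Ω → EuclideanSpace ℝ (Fin d)} {Y : ℤ → Ω → ℝ} {τ : ℕ → Ω → ℕ} {N : Ω → ℕ}

/-- Conditioning on N gives the series of the differences m (l + 1) - m l of the level means.
Integrability of Z makes it converge, and m l tends to θ, so its sum is θ - m 0. -/
lemma integral_Z (hμ : IsLeastSquaresLaw μ H θ σ R) (hd : 0 < d)
    (hH : H.PosSemidef) {a : ℝ} (ha : 0 ≤ a)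
    (haγ : γ ^ 2 * σ ^ 2 ≤ a * (γ * (2 - γ * R ^ 2))) (hγ : 0 ≤ γ * (2 - γ * R ^ 2))
    (hξ : 0 < xi γ R H) (hα' : α ≤ 1 / 2)
    (hδ : 0 ≤ δ) (hk : 2 ≤ k) (hX : ∀ t, Measurable (X t)) (hY : ∀ t, Measurable (Y t))
    (hi : iIndepFun (fun t ω => (X t ω, Y t ω)) P)
    (hlaw : ∀ t, P.map (fun ω => (X t ω, Y t ω)) = μ)
    (hτ : ∀ l, Measurable (τ l)) (hτlaw : ∀ l, P.map (τ l) = uniformOn (startRange α k l))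
    (hτXY : IndepFun (fun ω l => τ l ω) (fun ω t => (X t ω, Y t ω)) P)
    (hN : Measurable N) (hNlaw : ∀ l, P.real {ω | N ω = l} = levelProb δ l)
    (hNi : IndepFun N (fun ω => (fun l => τ l ω, fun t => (X t ω, Y t ω))) P)
    (hint : Integrable (Z γ δ θ₀ X Y τ N) P) :
    ∫ ω, Z γ δ θ₀ X Y τ N ω ∂P =
      θ - ((k : ℝ) - (burnIn α k : ℝ))⁻¹ • ∑ b ∈ Finset.Ico (burnIn α k) k,
        ((meanStep γ μ)^[b] (θ₀ - θ) + θ) := by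
  have : IsProbabilityMeasure μ := hlaw 0 ▸ Measure.isProbabilityMeasure_map
    ((hX 0).prodMk (hY 0)).aemeasurable
  set s : ℕ → Finset ℕ := fun l => Finset.Ico (levelStart α k l) (levelStart α k (l + 1)) with hs
  set m : ℕ → EuclideanSpace ℝ (Fin d) := fun l =>
    ∫ ω, sgdEnd γ θ₀ (τ l ω) (fun t => (X t ω, Y t ω)) ∂P with hm
  have hτs : ∀ l, P.map (τ l) = uniformOn (s l : Set ℕ) := fun l => by
    rw [hτlaw, startRange_eq]
  have hZm := fun t => (hX t).prodMk (hY t)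
  have hme : ∀ l, m l = ((s l).card : ℝ)⁻¹ • ∑ b ∈ s l, ((meanStep γ μ)^[b] (θ₀ - θ) + θ) :=
    fun l => integral_sgdEnd_uniformOn hμ hd hH ha haγ hγ hZm hi hlaw (hτ l) (hτs l)
      (hτXY.comp (φ := fun f : ℕ → ℕ => f l) (measurable_pi_apply l) measurable_id)
  have hint_m : ∀ l, Integrable (fun ω => sgdEnd γ θ₀ (τ l ω) (fun t => (X t ω, Y t ω))) P :=
    fun l => (memLp_sgdEnd_uniformOn hμ hd hH ha haγ hγ hZm hi hlaw (hτ l) (hτs l)).integrable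
      one_le_two
  have hlim : Filter.Tendsto m Filter.atTop (nhds θ) := by
    simp only [funext hme]
    refine tendsto_average ?_ (fun l => Finset.nonempty_Ico.2 (levelStart_lt hα' hk l))
      fun l b hb => (le_levelStart hk l).trans (Finset.mem_Ico.1 hb).1
    simpa using (hμ.tendsto_iterate_meanStep hd hH hγ hξ (θ₀ - θ)).add_const θ
  have hZe := funext (Z_eq_levelTerm γ δ θ₀ X Y τ N)
  have hsum : HasSum (fun l => m (l + 1) - m l) (∫ ω, Z γ δ θ₀ X Y τ N ω ∂P) := by
    rw [hZe] at hint ⊢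
    have h := hasSum_integral_indepFun hN (measurable_starts_data hX hY hτ) hNi
      (g := levelTerm γ δ θ₀) (measurable_levelTerm γ δ θ₀) hint
    refine h.congr_fun fun l => ?_
    have hp : P.real (N ⁻¹' {l}) = levelProb δ l := hNlaw l
    simp only [levelTerm]
    rw [integral_smul, integral_sub (hint_m (l + 1)) (hint_m l), hp, smul_smul,
      mul_inv_cancel₀ (levelProb_pos hδ l).ne', one_smul]
  have hlim' := hsum.tendsto_sum_nat
  simp only [Finset.sum_range_sub] at hlim'
  rw [tendsto_nhds_unique hlim' (hlim.sub_const (m 0)), hme 0]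
  have hb : burnIn α k < k := by have := burnIn_le hα' k; omega
  simp only [hs, levelStart]
  simp [Nat.cast_sub hb.le]

lemma integrable_thetaBar (hμ : IsLeastSquaresLaw μ H θ σ R) (hd : 0 < d)
    (hH : H.PosSemidef) {a : ℝ} (ha : 0 ≤ a)
    (haγ : γ ^ 2 * σ ^ 2 ≤ a * (γ * (2 - γ * R ^ 2))) (hγ : 0 ≤ γ * (2 - γ * R ^ 2))
    (hX : ∀ t, Measurable (X t)) (hY : ∀ t, Measurable (Y t))
    (hi : iIndepFun (fun t ω => (X t ω, Y t ω)) P)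
    (hlaw : ∀ t, P.map (fun ω => (X t ω, Y t ω)) = μ) :
    Integrable (thetaBar γ α θ₀ X Y k) P := by
  have hs : ∀ t : ℕ, Integrable (fun ω => sgd γ θ₀ (fun t => X t ω) (fun t => Y t ω) 0 t) P :=
    fun t => (memLp_sgdSteps hμ hd hH ha haγ hγ (fun t => (hX t).prodMk (hY t)) hi hlaw 0
      ((t : ℤ) - 0).toNat).integrable one_le_two
  exact (integrable_finsetSum (Finset.Ico (burnIn α k) k) fun t _ => hs t).smul
    ((k : ℝ) - (burnIn α k : ℝ))⁻¹

/-- The mean of an iterate depends only on its number of steps, not on its starting time; hence the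
agreement with the mean of level 0. -/
lemma integral_thetaBar (hμ : IsLeastSquaresLaw μ H θ σ R) (hd : 0 < d)
    (hH : H.PosSemidef) {a : ℝ} (ha : 0 ≤ a)
    (haγ : γ ^ 2 * σ ^ 2 ≤ a * (γ * (2 - γ * R ^ 2))) (hγ : 0 ≤ γ * (2 - γ * R ^ 2))
    (hX : ∀ t, Measurable (X t)) (hY : ∀ t, Measurable (Y t))
    (hi : iIndepFun (fun t ω => (X t ω, Y t ω)) P)
    (hlaw : ∀ t, P.map (fun ω => (X t ω, Y t ω)) = μ) :
    ∫ ω, thetaBar γ α θ₀ X Y k ω ∂P =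
      ((k : ℝ) - (burnIn α k : ℝ))⁻¹ • ∑ b ∈ Finset.Ico (burnIn α k) k,
        ((meanStep γ μ)^[b] (θ₀ - θ) + θ) := by
  have hZm := fun t => (hX t).prodMk (hY t)
  have hs : ∀ t : ℕ, Integrable (fun ω => sgd γ θ₀ (fun t => X t ω) (fun t => Y t ω) 0 t) P :=
    fun t => (memLp_sgdSteps hμ hd hH ha haγ hγ hZm hi hlaw 0
      ((t : ℤ) - 0).toNat).integrable one_le_two
  simp only [thetaBar]
  rw [integral_smul, integral_finsetSum _ fun t _ => hs t]
  congr 1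
  refine Finset.sum_congr rfl fun t _ => ?_
  have := integral_sgdSteps (θ₀ := θ₀) hμ hd hH ha haγ hγ hZm hi hlaw 0 ((t : ℤ) - 0).toNat
  simpa [sgd] using this

end SingleTermExpectation

lemma tsum_ofReal_le_of_sum_range_succ_le {w : ℕ → ℝ} (hw : ∀ l, 0 ≤ w l) {C : ℝ}
    (h : ∀ n, ∑ l ∈ Finset.range (n + 1), w l ≤ C) :
    ∑' l, ENNReal.ofReal (w l) ≤ ENNReal.ofReal C := by
  rw [ENNReal.tsum_eq_iSup_nat]
  refine iSup_le fun n => ?_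
  calc ∑ l ∈ Finset.range n, ENNReal.ofReal (w l)
      ≤ ∑ l ∈ Finset.range (n + 1), ENNReal.ofReal (w l) :=
        Finset.sum_le_sum_of_subset (Finset.range_subset_range.2 n.le_succ)
    _ = ENNReal.ofReal (∑ l ∈ Finset.range (n + 1), w l) :=
        (ENNReal.ofReal_sum_of_nonneg fun l _ => hw l).symm
    _ ≤ _ := ENNReal.ofReal_le_ofReal (h n)

end LeastSquaresSGD

/-! ### The main theorem -/

open LeastSquaresSGD

theorem mainTheorem3 {d : ℕ} (hd : 0 < d)
    -- the random pair `(x, y)`, with its Hessian `H` and the minimizer `θ*`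
    {Ω₀ : Type*} [MeasurableSpace Ω₀] (P₀ : Measure Ω₀) [IsProbabilityMeasure P₀]
    (x : Ω₀ → EuclideanSpace ℝ (Fin d)) (y : Ω₀ → ℝ)
    (hx : MemLp x 2 P₀) (hy : MemLp y 2 P₀)
    (H : Matrix (Fin d) (Fin d) ℝ) (hH : H = LeastSquaresSGD.hessian P₀ x) (hHpos : H.PosDef)
    (θstar : EuclideanSpace ℝ (Fin d)) (hθstar : LeastSquaresSGD.NormalEquation P₀ x y θstar)
    -- the main assumption on the law of `(x, y)`
    (σ R : ℝ) (hσ : 0 < σ) (hR : 0 < R)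
    (hAσ : LeastSquaresSGD.WeightedSecondMomentLE P₀
      (fun ω => (y ω - inner ℝ (x ω) θstar) ^ 2) x (σ ^ 2 • H))
    (hAR : LeastSquaresSGD.WeightedSecondMomentLE P₀ (fun ω => ‖x ω‖ ^ 2) x (R ^ 2 • H))
    -- parameters
    (γ α δ : ℝ) (hγ : 0 < γ) (hγR : γ < 2 / R ^ 2) (hα : 0 < α) (hα' : α ≤ 1 / 2) (hδ : 1 < δ)
    (θ₀ : EuclideanSpace ℝ (Fin d)) (k : ℕ) (hk : 2 ≤ k)
    -- independent copies `(X t, Y t)`, `t ∈ ℤ`, of `(x, y)`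
    {Ω : Type*} [MeasurableSpace Ω] (P : Measure Ω) [IsProbabilityMeasure P]
    (X : ℤ → Ω → EuclideanSpace ℝ (Fin d)) (Y : ℤ → Ω → ℝ)
    (hX : ∀ t, Measurable (X t)) (hY : ∀ t, Measurable (Y t))
    (hcopy : ∀ t, IdentDistrib (fun ω => (X t ω, Y t ω)) (fun ω => (x ω, y ω)) P P₀)
    (hindep : iIndepFun (fun t ω => (X t ω, Y t ω)) P)
    -- the independent random starts `τ l = τ(k,l)`, independent of the copies
    (τ : ℕ → Ω → ℕ) (hτ : ∀ l, Measurable (τ l))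
    (hτlaw : ∀ l, P.map (τ l) = uniformOn (LeastSquaresSGD.startRange α k l))
    (hτindep : iIndepFun τ P)
    (hτXY : IndepFun (fun ω l => τ l ω) (fun ω t => (X t ω, Y t ω)) P)
    -- the random level `N`, independent of the copies and of the starts
    (N : Ω → ℕ) (hN : Measurable N)
    (hNlaw : ∀ l, P.real {ω | N ω = l} = LeastSquaresSGD.levelProb δ l)
    (hNindep : IndepFun N (fun ω => (fun l => τ l ω, fun t => (X t ω, Y t ω))) P) :
    MemLp (LeastSquaresSGD.Z γ δ θ₀ X Y τ N) 2 P ∧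
    Integrable (LeastSquaresSGD.thetaBar γ α θ₀ X Y k) P ∧
    ∫ ω, LeastSquaresSGD.Z γ δ θ₀ X Y τ N ω ∂P =
      θstar - ∫ ω, LeastSquaresSGD.thetaBar γ α θ₀ X Y k ω ∂P ∧
    k * ∫ ω, LeastSquaresSGD.sqNorm H (LeastSquaresSGD.Z γ δ θ₀ X Y τ N ω) ∂P ≤
      11 * LeastSquaresSGD.cConst γ σ R θ₀ θstar / α +
        6 * LeastSquaresSGD.cConst γ σ R θ₀ θstar *
          (4 * Real.log ((4 * δ + 8) / (α * LeastSquaresSGD.xi γ R H))) ^ (δ + 1) ∧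
    ((4 * δ + 8) / (α * LeastSquaresSGD.xi γ R H) *
        Real.log ((4 * δ + 8) / (α * LeastSquaresSGD.xi γ R H)) ≤ k →
      k * ∫ ω, LeastSquaresSGD.sqNorm H (LeastSquaresSGD.Z γ δ θ₀ X Y τ N ω) ∂P ≤
        24 * LeastSquaresSGD.cConst γ σ R θ₀ θstar / (k : ℝ) ^ (δ + 1) *
          Real.exp (-(α * LeastSquaresSGD.xi γ R H * k / 2))) := by
  subst hH
  have hlaw : ∀ t, P.map (fun ω => (X t ω, Y t ω)) = P₀.map fun ω => (x ω, y ω) := fun t =>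
    (hcopy t).map_eq
  have hμ := isLeastSquaresLaw_map hx hy hθstar hAσ hAR
  have : IsProbabilityMeasure (P₀.map fun ω => (x ω, y ω)) :=
    Measure.isProbabilityMeasure_map (hx.1.aemeasurable.prodMk hy.1.aemeasurable)
  have hH := hHpos.posSemidef
  have hγ2 : 0 < 2 - γ * R ^ 2 := by
    rw [lt_div_iff₀ (by positivity)] at hγR
    linarith
  have hκ : 0 < γ * (2 - γ * R ^ 2) := mul_pos hγ hγ2
  have hδ0 : 0 ≤ δ := by linarith
  have hlam := lambdaMin_pos hd hHpos
  have hξ : 0 < xi γ R (hessian P₀ x) := mul_pos hκ hlam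
  have hρ0 := sub_nonneg.2 (hμ.xi_le_one hd hH hκ.le)
  have ha : 0 ≤ γ * σ ^ 2 / (2 - γ * R ^ 2) := by positivity
  have haγ : γ ^ 2 * σ ^ 2 ≤ γ * σ ^ 2 / (2 - γ * R ^ 2) * (γ * (2 - γ * R ^ 2)) := by
    apply le_of_eq
    field_simp
  have hc : 0 ≤ cConst γ σ R θ₀ θstar := by unfold cConst; positivity
  have hk0 : (0 : ℝ) < k := by positivity
  have hZm := measurable_Z (γ := γ) (δ := δ) (θ₀ := θ₀) hX hY hτ hN
  have hqm : AEStronglyMeasurable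
      (fun ω => sqNorm (hessian P₀ x) (Z γ δ θ₀ X Y τ N ω)) P :=
    ((continuous_sqNorm _).measurable.comp hZm).aestronglyMeasurable
  have hbound := lintegral_sqNorm_Z_le (θ₀ := θ₀) hμ hd hH hγ hγ2 hα' hδ0 hk hX hY hindep hlaw
    hτ hτlaw hτindep hτXY hN hNlaw hNindep
  have hw : ∀ l, 0 ≤ (levelProb δ l)⁻¹ *
      (6 * cConst γ σ R θ₀ θstar * (1 - xi γ R (hessian P₀ x)) ^ levelStart α k l /
        (levelStart α k (l + 1) - levelStart α k l)) := fun l => by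
    have h1 := levelProb_pos hδ0 l
    have h2 : (0 : ℝ) ≤ levelStart α k (l + 1) - levelStart α k l :=
      sub_nonneg.2 (by exact_mod_cast (levelStart_lt hα' hk l).le)
    positivity
  have key : ∀ C, (∀ n, cConst γ σ R θ₀ θstar *
      (36 * (1 - xi γ R (hessian P₀ x)) ^ burnIn α k + 12 * ∑ l ∈ Finset.range n,
        ((l : ℝ) + 2) ^ δ * (1 - xi γ R (hessian P₀ x)) ^ (k * (2 ^ (l + 1) - 1))) ≤ C) →
      ∫⁻ ω, ENNReal.ofReal (sqNorm (hessian P₀ x) (Z γ δ θ₀ X Y τ N ω)) ∂P ≤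
        ENNReal.ofReal (C / k) := fun C hC => by
    refine hbound.trans (tsum_ofReal_le_of_sum_range_succ_le hw fun n => ?_)
    rw [le_div_iff₀' hk0]
    exact (mul_sum_levels_le hδ0 hρ0 hα' hk hc n).trans (hC n)
  have key' : ∀ C, (∀ n, cConst γ σ R θ₀ θstar *
      (36 * (1 - xi γ R (hessian P₀ x)) ^ burnIn α k + 12 * ∑ l ∈ Finset.range n,
        ((l : ℝ) + 2) ^ δ * (1 - xi γ R (hessian P₀ x)) ^ (k * (2 ^ (l + 1) - 1))) ≤ C) →
      k * ∫ ω, sqNorm (hessian P₀ x) (Z γ δ θ₀ X Y τ N ω) ∂P ≤ C := fun C hC => by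
    have hC0 : 0 ≤ C := le_trans (by positivity) (hC 0)
    rw [← le_div_iff₀' hk0]
    exact integral_le_of_lintegral_ofReal_le hqm (fun ω => sqNorm_nonneg hH _) (by positivity)
      (key C hC)
  have hC1 : ∀ n, cConst γ σ R θ₀ θstar *
      (36 * (1 - xi γ R (hessian P₀ x)) ^ burnIn α k + 12 * ∑ l ∈ Finset.range n,
        ((l : ℝ) + 2) ^ δ * (1 - xi γ R (hessian P₀ x)) ^ (k * (2 ^ (l + 1) - 1))) ≤
      11 * cConst γ σ R θ₀ θstar / α + 6 * cConst γ σ R θ₀ θstar *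
        (4 * Real.log ((4 * δ + 8) / (α * xi γ R (hessian P₀ x)))) ^ (δ + 1) := fun n => by
    have h1 := sum_level_le hδ hξ rfl hρ0 hα hα' hk n
    -- The first bound discards the burn-in factor of level 0; the constant 22 becomes 11/α because
    -- α ≤ 1/2.
    have h2 : (1 - xi γ R (hessian P₀ x)) ^ burnIn α k ≤ 1 := pow_le_one₀ hρ0 (by linarith)
    have h3 : 22 * cConst γ σ R θ₀ θstar ≤ 11 * cConst γ σ R θ₀ θstar / α := by
      rw [le_div_iff₀ hα]
      nlinarith
    have h4 := mul_le_mul_of_nonneg_left ((add_le_add_left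
      (mul_le_mul_of_nonneg_left h2 (by norm_num : (0 : ℝ) ≤ 36)) _).trans
        ((mul_one (36 : ℝ)).symm ▸ h1)) hc
    linarith
  have hmem : MemLp (Z γ δ θ₀ X Y τ N) 2 P := by
    refine (memLp_two_iff_integrable_sq_norm hZm.aestronglyMeasurable).2 ?_
    -- The moment bound gives integrability of ‖Z‖²_H, and the positive smallest eigenvalue
    -- transfers it to ‖Z‖².
    have hq := integrable_of_lintegral_ofReal_le hqm (fun ω => sqNorm_nonneg hH _) (key _ hC1)
    refine (hq.const_mul (lambdaMin (hessian P₀ x))⁻¹).mono'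
      (hZm.norm.pow_const 2).aestronglyMeasurable (Filter.Eventually.of_forall fun ω => ?_)
    rw [Real.norm_of_nonneg (sq_nonneg _), ← div_eq_inv_mul, le_div_iff₀' hlam]
    exact lambdaMin_mul_norm_sq_le hH.1 _
  refine ⟨hmem, integrable_thetaBar hμ hd hH ha haγ hκ.le hX hY hindep hlaw, ?_, key' _ hC1,
    fun hkA => key' _ fun n => ?_⟩
  · rw [integral_thetaBar hμ hd hH ha haγ hκ.le hX hY hindep hlaw]
    exact integral_Z hμ hd hH ha haγ hκ.le hξ hα' hδ0 hk hX hY hindep hlaw hτ hτlaw hτXY hN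
      hNlaw hNindep (hmem.integrable one_le_two)
  · refine (mul_le_mul_of_nonneg_left
      (sum_level_le_of_le hδ hξ rfl hρ0 hα hα' hk hkA n) hc).trans (le_of_eq ?_)
    ring
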